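/- Conventions. All Banach spaces are complex. For a Banach algebra $\mathcal A$, a Banach $\mathcal A$-bimodule $E$ (bounded bilinear actions) is *dual* with predual $E_*$ if $E_*$ is a closed submodule of $E^*$ such that the canonical map $E\to (E_*)^*$ is an isometric isomorphism; the $w^*$-topology of $E$ is the one induced by $E_*$. $\mathcal A$ is a *dual Banach algebra* with predual $\mathcal A_*$ if it is dual, with predual $\mathcal A_*$, as a bimodule over itself. A dual bimodule $E$ over a dual Banach algebra $\mathcal A$ is *normal* if for each $x\in E$ the maps $a\mapsto a\cdot x$ and $a\mapsto x\cdot a$ from $\mathcal A$ to $E$ are $w^*$-continuous. A *derivation* $D:\mathcal A\to E$ is a bounded linear map with $D(ab)=Da\cdot b+a\cdot Db$. A dual Banach algebra $\mathcal A$ is * *Connes amenable* if for every $w^*$-continuous derivation $D$ from $\mathcal A$ into a normal dual Banach $\mathcal A$-bimodule $E$ there is $x\in E$ with $D(a)=a\cdot x-x\cdot a$ for all $a\in\mathcal A$; * *pointwise Connes amenable* if for every $a_0\in\mathcal A$ and every such $E$ and $D$ there is $x\in E$ with $D(a_0)=a_0\cdot x-x\cdot a_0$; * *$w^*$-approximately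 Connes amenable* if for every such $E$ and $D$ there is a net $(x_i)$ in $E$ with $D(a)=w^*\text{-}\lim_i(a\cdot x_i-x_i\cdot a)$ for all $a\in\mathcal A$; * *pointwise $w^*$-approximately Connes amenable* if for every $a_0\in\mathcal A$ and every such $E$ and $D$ there is a net $(x_i)$ in $E$ with $D(a_0)=w^*\text{-}\lim_i(a_0\cdot x_i-x_i\cdot a_0)$. **Theorem 3.1.** Let $\omega:\mathbb N\to[1,\infty)$ be any function (in particular, any weight on $\mathbb N$). Let $\ell^1(\omega)$ be the algebra, under pointwise multiplication, of all complex sequences $f$ with $\|f\|=\sum_n|f(n)|\,\omega(n)<\infty$. It is a dual Banach algebra with predual $c_0(\omega^{-1})=\{w:\mathbb N\to\mathbb C : w(n)/\omega(n)\to 0\}$, under the pairing $\langle f,w\rangle=\sum_n f(n)w(n)$, and: (i) $\ell^1(\omega)$ is not Connes amenable; (ii) $\ell^1(\omega)$ is not pointwise Connes amenable; (iii) $\ell^1(\omega)$ is not $w^*$-approximately Connes amenable; (iv) $\ell^1(\omega)$ is pointwise $w^*$-approximately Connes amenable. -/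

import Mathlib

universe u v

noncomputable section

/-! ### Weak-star topologies -/

/-- The weak-star topology on `E` given by a space `P` of functionals on `E`: the coarsest topology
that makes all `φ ∈ P` continuous, so that nets converge iff they converge against every
`φ ∈ P`. -/
abbrev weakStarTopology {E : Type v} [NormedAddCommGroup E] [NormedSpace ℂ E]
    (P : Submodule ℂ (StrongDual ℂ E)) : TopologicalSpace E :=
  TopologicalSpace.induced (fun (x : E) (φ : P) => (φ : StrongDual ℂ E) x) Pi.topologicalSpace

/-- `T : E → F` is continuous for the weak-star topologies given by `P` and `Q`. -/
def WeakStarContinuous {E : Type u} {F : Type v} [NormedAddCommGroup E] [NormedSpace ℂ E]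
    [NormedAddCommGroup F] [NormedSpace ℂ F] (P : Submodule ℂ (StrongDual ℂ E))
    (Q : Submodule ℂ (StrongDual ℂ F)) (T : E → F) : Prop :=
  @Continuous E F (weakStarTopology P) (weakStarTopology Q) T

/-! ### Banach bimodules -/

/-- The structure of a Banach `A`-bimodule on a Banach space `E`, for a Banach algebra `A` that
need not be unital: `left a x = a · x` and `right a x = x · a` are bounded bilinear. -/
structure BanachBimodule (A : Type u) (E : Type v) [NonUnitalNormedRing A] [NormedSpace ℂ A]
    [NormedAddCommGroup E] [NormedSpace ℂ E] where
  /-- `left a x` is `a · x`. -/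
  left : A →L[ℂ] E →L[ℂ] E
  /-- `right a x` is `x · a`. -/
  right : A →L[ℂ] E →L[ℂ] E
  left_mul : ∀ a b x, left (a * b) x = left a (left b x)
  right_mul : ∀ a b x, right (a * b) x = right b (right a x)
  left_right : ∀ a b x, left a (right b x) = right b (left a x)

namespace BanachBimodule

/-- The algebra `A` as a bimodule over itself. -/
def self (A : Type u) [NonUnitalNormedRing A] [NormedSpace ℂ A] [IsScalarTower ℂ A A]
    [SMulCommClass ℂ A A] : BanachBimodule A A where
  left := ContinuousLinearMap.mul ℂ A
  right := (ContinuousLinearMap.mul ℂ A).flip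
  left_mul a b x := by simp [mul_assoc]
  right_mul a b x := by simp [mul_assoc]
  left_right a b x := by simp [mul_assoc]

variable {A : Type u} {E : Type v} [NonUnitalNormedRing A] [NormedSpace ℂ A]
  [NormedAddCommGroup E] [NormedSpace ℂ E]

/-- `P` is a predual `E_*` of the bimodule `E`: a closed subspace of `E*`, invariant under the dual
actions `(φ · a)(x) = φ(a · x)` and `(a · φ)(x) = φ(x · a)`, such that the canonical map
`E → (E_*)*`, `x ↦ (φ ↦ φ x)`, is isometric (`‖x‖` is at most the norm of its image, the other
inequality being automatic) and surjective (every bounded functional on `E_*` is a point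
evaluation). -/
structure IsPredual (M : BanachBimodule A E) (P : Submodule ℂ (StrongDual ℂ E)) : Prop where
  isClosed : IsClosed (P : Set (StrongDual ℂ E))
  comp_left_mem : ∀ a : A, ∀ φ ∈ P, φ.comp (M.left a) ∈ P
  comp_right_mem : ∀ a : A, ∀ φ ∈ P, φ.comp (M.right a) ∈ P
  norm_le : ∀ (x : E) (C : ℝ), 0 ≤ C → (∀ φ ∈ P, ‖φ x‖ ≤ C * ‖φ‖) → ‖x‖ ≤ C
  exists_eval : ∀ F : P →ₗ[ℂ] ℂ, (∃ C : ℝ, ∀ φ : P, ‖F φ‖ ≤ C * ‖(φ : StrongDual ℂ E)‖) →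
    ∃ x : E, ∀ φ : P, F φ = (φ : StrongDual ℂ E) x

/-- A dual bimodule `E = P*` over a dual Banach algebra `A = (PA)*` is normal: for each `x`,
the maps `a ↦ a · x` and `a ↦ x · a` are weak-star continuous. -/
structure IsNormal (PA : Submodule ℂ (StrongDual ℂ A)) (M : BanachBimodule A E)
    (P : Submodule ℂ (StrongDual ℂ E)) : Prop where
  left : ∀ x : E, WeakStarContinuous PA P (fun a => M.left a x)
  right : ∀ x : E, WeakStarContinuous PA P (fun a => M.right a x)

/-- A bounded linear map `D` is a derivation: `D(ab) = Da · b + a · Db`. -/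
def IsDerivation (M : BanachBimodule A E) (D : A →L[ℂ] E) : Prop :=
  ∀ a b : A, D (a * b) = M.right b (D a) + M.left a (D b)

/-- `D` is inner. -/
def IsInner (M : BanachBimodule A E) (D : A →L[ℂ] E) : Prop :=
  ∃ x : E, ∀ a : A, D a = M.left a x - M.right a x

/-- `D` is pointwise inner at `a₀`. -/
def IsInnerAt (M : BanachBimodule A E) (D : A →L[ℂ] E) (a₀ : A) : Prop :=
  ∃ x : E, D a₀ = M.left a₀ x - M.right a₀ x

/-- `D` is weak-star approximately inner: one net `(x i)` in `E` satisfies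
`D a = w*-lim (a · x i - x i · a)` for all `a`. -/
def IsWeakStarApproxInner (M : BanachBimodule A E) (P : Submodule ℂ (StrongDual ℂ E))
    (D : A →L[ℂ] E) : Prop :=
  ∃ (ι : Type v) (_ : Nonempty ι) (_ : Preorder ι) (_ : IsDirectedOrder ι) (x : ι → E),
    ∀ a : A, Filter.Tendsto (fun i => M.left a (x i) - M.right a (x i)) Filter.atTop
      (@nhds E (weakStarTopology P) (D a))

/-- `D` is pointwise weak-star approximately inner at `a₀`. -/
def IsWeakStarApproxInnerAt (M : BanachBimodule A E) (P : Submodule ℂ (StrongDual ℂ E))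
    (D : A →L[ℂ] E) (a₀ : A) : Prop :=
  ∃ (ι : Type v) (_ : Nonempty ι) (_ : Preorder ι) (_ : IsDirectedOrder ι) (x : ι → E),
    Filter.Tendsto (fun i => M.left a₀ (x i) - M.right a₀ (x i)) Filter.atTop
      (@nhds E (weakStarTopology P) (D a₀))

end BanachBimodule

/-! ### Dual Banach algebras and Connes amenability -/

section Amenability

variable (A : Type u) [NonUnitalNormedRing A] [NormedSpace ℂ A]

/-- The Banach algebra `A` is a dual Banach algebra with predual `PA`. -/
def IsDualBanachAlgebra [IsScalarTower ℂ A A] [SMulCommClass ℂ A A]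
    (PA : Submodule ℂ (StrongDual ℂ A)) : Prop :=
  CompleteSpace A ∧ (BanachBimodule.self A).IsPredual PA

/-- Connes amenability of the dual Banach algebra `A` with predual `PA`. -/
def IsConnesAmenable (PA : Submodule ℂ (StrongDual ℂ A)) : Prop :=
  ∀ (E : Type v) [NormedAddCommGroup E] [NormedSpace ℂ E] [CompleteSpace E]
    (M : BanachBimodule A E) (P : Submodule ℂ (StrongDual ℂ E)),
    M.IsPredual P → M.IsNormal PA P →
    ∀ D : A →L[ℂ] E, M.IsDerivation D → WeakStarContinuous PA P D → M.IsInner D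

/-- Pointwise Connes amenability at `a₀`. -/
def IsConnesAmenableAt (PA : Submodule ℂ (StrongDual ℂ A)) (a₀ : A) : Prop :=
  ∀ (E : Type v) [NormedAddCommGroup E] [NormedSpace ℂ E] [CompleteSpace E]
    (M : BanachBimodule A E) (P : Submodule ℂ (StrongDual ℂ E)),
    M.IsPredual P → M.IsNormal PA P →
    ∀ D : A →L[ℂ] E, M.IsDerivation D → WeakStarContinuous PA P D → M.IsInnerAt D a₀

/-- Pointwise Connes amenability. -/
def IsPointwiseConnesAmenable (PA : Submodule ℂ (StrongDual ℂ A)) : Prop :=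
  ∀ a₀ : A, IsConnesAmenableAt.{u, v} A PA a₀

/-- Weak-star approximate Connes amenability. -/
def IsWeakStarApproxConnesAmenable (PA : Submodule ℂ (StrongDual ℂ A)) : Prop :=
  ∀ (E : Type v) [NormedAddCommGroup E] [NormedSpace ℂ E] [CompleteSpace E]
    (M : BanachBimodule A E) (P : Submodule ℂ (StrongDual ℂ E)),
    M.IsPredual P → M.IsNormal PA P →
    ∀ D : A →L[ℂ] E, M.IsDerivation D → WeakStarContinuous PA P D →
      M.IsWeakStarApproxInner P D

/-- Pointwise weak-star approximate Connes amenability at `a₀`. -/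
def IsWeakStarApproxConnesAmenableAt (PA : Submodule ℂ (StrongDual ℂ A)) (a₀ : A) : Prop :=
  ∀ (E : Type v) [NormedAddCommGroup E] [NormedSpace ℂ E] [CompleteSpace E]
    (M : BanachBimodule A E) (P : Submodule ℂ (StrongDual ℂ E)),
    M.IsPredual P → M.IsNormal PA P →
    ∀ D : A →L[ℂ] E, M.IsDerivation D → WeakStarContinuous PA P D →
      M.IsWeakStarApproxInnerAt P D a₀

/-- Pointwise weak-star approximate Connes amenability. -/
def IsPointwiseWeakStarApproxConnesAmenable (PA : Submodule ℂ (StrongDual ℂ A)) : Prop :=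
  ∀ a₀ : A, IsWeakStarApproxConnesAmenableAt.{u, v} A PA a₀

end Amenability

/-! ### The Banach sequence algebra `ℓ¹(ω)` and its predual `c₀(ω⁻¹)` -/

/-- The algebra, under pointwise operations, of all complex sequences `f` such that
`∑ |f n| ω n < ∞`. -/
def weightedL1Subalgebra (ω : ℕ → Set.Ici (1 : ℝ)) : NonUnitalSubalgebra ℂ (ℕ → ℂ) where
  carrier := {f | Summable fun n => ‖f n‖ * (ω n : ℝ)}
  zero_mem' := by simp [summable_zero]
  add_mem' {f g} hf hg := by
    refine Summable.of_nonneg_of_le (fun n => ?_) (fun n => ?_) (Summable.add hf hg)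
    · exact mul_nonneg (norm_nonneg _) (zero_le_one.trans (ω n).2)
    · rw [← add_mul]
      exact mul_le_mul_of_nonneg_right (norm_add_le _ _) (zero_le_one.trans (ω n).2)
  smul_mem' c f hf := by
    have h : Summable fun n => ‖c‖ * (‖f n‖ * (ω n : ℝ)) := Summable.mul_left ‖c‖ hf
    refine h.congr (fun n => ?_)
    simp [mul_assoc]
  mul_mem' {f g} hf hg := by
    have hf' : Summable fun n => ‖f n‖ * (ω n : ℝ) := hf
    have hg' : Summable fun n => ‖g n‖ * (ω n : ℝ) := hg
    have h0 : ∀ n, (0 : ℝ) ≤ ω n := fun n => zero_le_one.trans (ω n).2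
    refine Summable.of_nonneg_of_le (fun n => ?_) (fun n => ?_)
      (hf'.mul_left (∑' n, ‖g n‖ * (ω n : ℝ)))
    · exact mul_nonneg (norm_nonneg _) (h0 n)
    · have h1 : ‖g n‖ ≤ ∑' n, ‖g n‖ * (ω n : ℝ) :=
        (le_mul_of_one_le_right (norm_nonneg _) (ω n).2).trans
          (hg'.le_tsum n fun m _ => mul_nonneg (norm_nonneg _) (h0 m))
      have h2 := mul_le_mul_of_nonneg_right h1 (mul_nonneg (norm_nonneg (f n)) (h0 n))
      calc ‖(f * g) n‖ * (ω n : ℝ) = ‖g n‖ * (‖f n‖ * (ω n : ℝ)) := by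
            simp only [Pi.mul_apply, norm_mul]; ring
        _ ≤ _ := h2

/-- The Banach algebra `ℓ¹(ω)`, with pointwise product. -/
def WeightedL1 (ω : ℕ → Set.Ici (1 : ℝ)) : Type := weightedL1Subalgebra ω

namespace WeightedL1

variable {ω : ℕ → Set.Ici (1 : ℝ)}

instance : NonUnitalCommRing (WeightedL1 ω) :=
  inferInstanceAs (NonUnitalCommRing (weightedL1Subalgebra ω))

instance : Module ℂ (WeightedL1 ω) := inferInstanceAs (Module ℂ (weightedL1Subalgebra ω))

instance : IsScalarTower ℂ (WeightedL1 ω) (WeightedL1 ω) :=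
  inferInstanceAs (IsScalarTower ℂ (weightedL1Subalgebra ω) (weightedL1Subalgebra ω))

instance : SMulCommClass ℂ (WeightedL1 ω) (WeightedL1 ω) :=
  inferInstanceAs (SMulCommClass ℂ (weightedL1Subalgebra ω) (weightedL1Subalgebra ω))

instance : CoeFun (WeightedL1 ω) (fun _ => ℕ → ℂ) := ⟨fun f => f.1⟩

@[simp] lemma add_apply (f g : WeightedL1 ω) (n : ℕ) : (f + g) n = f n + g n := rfl
@[simp] lemma smul_apply (c : ℂ) (f : WeightedL1 ω) (n : ℕ) : (c • f) n = c * f n := rfl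
@[simp] lemma mul_apply (f g : WeightedL1 ω) (n : ℕ) : (f * g) n = f n * g n := rfl
@[simp] lemma zero_apply (n : ℕ) : (0 : WeightedL1 ω) n = 0 := rfl

lemma summable (f : WeightedL1 ω) : Summable fun n => ‖f n‖ * (ω n : ℝ) := f.2

lemma weight_pos (ω : ℕ → Set.Ici (1 : ℝ)) (n : ℕ) : (0 : ℝ) < ω n :=
  zero_lt_one.trans_le (ω n).2

/-- The norm `‖f‖ = ∑ |f n| ω n`. -/
instance : Norm (WeightedL1 ω) := ⟨fun f => ∑' n, ‖f n‖ * (ω n : ℝ)⟩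

lemma norm_def (f : WeightedL1 ω) : ‖f‖ = ∑' n, ‖f n‖ * (ω n : ℝ) := rfl

lemma term_nonneg (f : WeightedL1 ω) (n : ℕ) : 0 ≤ ‖f n‖ * (ω n : ℝ) :=
  mul_nonneg (norm_nonneg _) (weight_pos ω n).le

lemma term_le_norm (f : WeightedL1 ω) (n : ℕ) : ‖f n‖ * (ω n : ℝ) ≤ ‖f‖ :=
  f.summable.le_tsum n fun m _ => f.term_nonneg m

lemma normedSpaceCore : NormedSpace.Core ℂ (WeightedL1 ω) where
  norm_nonneg f := tsum_nonneg f.term_nonneg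
  norm_smul c f := by
    rw [norm_def, norm_def, ← tsum_mul_left]
    exact tsum_congr fun n => by simp [mul_assoc]
  norm_triangle f g := by
    rw [norm_def, norm_def, norm_def, ← f.summable.tsum_add g.summable]
    refine (f + g).summable.tsum_le_tsum (fun n => ?_) (f.summable.add g.summable)
    rw [← add_mul]
    exact mul_le_mul_of_nonneg_right (norm_add_le _ _) (weight_pos ω n).le
  norm_eq_zero_iff f := by
    constructor
    · intro h
      apply Subtype.ext
      funext n
      have h1 := (f.term_le_norm n).trans h.le
      have h2 := le_antisymm h1 (f.term_nonneg n)
      rcases mul_eq_zero.1 h2 with h3 | h3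
      · exact norm_eq_zero.1 h3
      · exact absurd h3 (weight_pos ω n).ne'
    · rintro rfl
      simp [norm_def]

instance : NormedAddCommGroup (WeightedL1 ω) := NormedAddCommGroup.ofCore normedSpaceCore

instance : NonUnitalNormedCommRing (WeightedL1 ω) :=
  { (inferInstance : NormedAddCommGroup (WeightedL1 ω)),
    (inferInstance : NonUnitalCommRing (WeightedL1 ω)) with
    norm_mul_le := fun f g => by
      change ‖f * g‖ ≤ ‖f‖ * ‖g‖
      have h : ∀ n, ‖(f * g) n‖ * (ω n : ℝ) ≤ (‖f n‖ * (ω n : ℝ)) * ‖g‖ := fun n => by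
        have h1 : ‖g n‖ ≤ ‖g‖ :=
          (le_mul_of_one_le_right (norm_nonneg _) (ω n).2).trans (g.term_le_norm n)
        calc ‖(f * g) n‖ * (ω n : ℝ) = (‖f n‖ * (ω n : ℝ)) * ‖g n‖ := by
              simp only [mul_apply, norm_mul]; ring
          _ ≤ _ := mul_le_mul_of_nonneg_left h1 (f.term_nonneg n)
      rw [norm_def f, ← tsum_mul_right]
      exact (f * g).summable.tsum_le_tsum h (f.summable.mul_right _) }

instance : NormedSpace ℂ (WeightedL1 ω) := NormedSpace.ofCore normedSpaceCore

variable (ω) in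
/-- The predual `c₀(ω⁻¹)`, as a space of functionals on `ℓ¹(ω)`: the sequences `w` such that
`w n / ω n → 0`, acting by `f ↦ ∑ f n * w n`. -/
def predual : Submodule ℂ (StrongDual ℂ (WeightedL1 ω)) where
  carrier := {φ | ∃ w : ℕ → ℂ,
    Filter.Tendsto (fun n => w n / ((ω n : ℝ) : ℂ)) Filter.atTop (nhds 0) ∧
      ∀ f : WeightedL1 ω, HasSum (fun n => f n * w n) (φ f)}
  zero_mem' := ⟨0, by simp, fun f => by simp⟩
  add_mem' := by
    rintro φ ψ ⟨w, hw, hφ⟩ ⟨z, hz, hψ⟩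
    refine ⟨w + z, ?_, fun f => ?_⟩
    · simpa [add_div] using hw.add hz
    · simpa [mul_add] using (hφ f).add (hψ f)
  smul_mem' := by
    rintro c φ ⟨w, hw, hφ⟩
    refine ⟨c • w, ?_, fun f => ?_⟩
    · simpa [mul_div_assoc] using hw.const_mul c
    · simpa [mul_left_comm] using (hφ f).mul_left c

end WeightedL1

end

/-!
The algebra `A = ℓ¹(ω)` is isometric, as a Banach space, to `ℓ¹(ℕ)` by `f ↦ f ω`, and `c₀(ω⁻¹)` then
becomes `c₀(ℕ)`; so `A` is a dual Banach algebra.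

*Pointwise approximation.* Let `D` be a derivation into a dual bimodule with predual `P`, and fix
`a`. By finite-dimensional duality it is enough that every `φ ∈ P` vanishing on all commutators
`a · x - x · a` vanishes at `D a`
(`BanachBimodule.isWeakStarApproxInnerAt_of_forall`). Since `a → 0`, `a` is the sum of its spectral
idempotents `p` times the eigenvalues, and `D p = D p · p + p · D p` is off-diagonal for `p`. The left and right actions of `a` on an
off-diagonal vector have disjoint spectra, so the vector is a commutator with `a`, and `φ` kills it
(`BanachBimodule.IsDerivation.apply_eq_zero`).

*The negative results.* All of them come from one derivation, `D a = a ⊗ 1 - 1 ⊗ a` into the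
sub-bimodule `E = A ⊗ A + A ⊗ 1 + 1 ⊗ A` of `A♯ ⊗ A♯`, with `A♯` the unitization
(`TensorBimodule.bimodule`, `TensorBimodule.derivation`). As a Banach space `E` is an `ℓ¹`-space
with predual `c₀`, and it is normal. If `a` has infinitely many nonzero entries, then `D a` is not a
commutator with `a`: the coefficient of `⊗ 1` in `x` would have to be the constant `1`, which is not
summable (`TensorBimodule.not_isInnerAt_derivation`).

For the approximate statement one needs `a₁, a₂ ∈ A` and `φ₁, φ₂ ∈ c₀` such that
`φ₁ (a₁ · x - x · a₁) + φ₂ (a₂ · x - x · a₂)` vanishes for all `x ∈ E` while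
`φ₁ (D a₁) + φ₂ (D a₂) ≠ 0`. On the coordinates `v ⊗ w` the vanishing says that
`a₁ v φ₁ + a₂ v φ₂ = a₁ w φ₁ + a₂ w φ₂`; calling this number `c (v, w)`, the coordinates `v ⊗ 1` and
`1 ⊗ w` say that the row and column sums of `c` are prescribed by the values of `φ₁` and `φ₂` there.
So `c` may be chosen as an antisymmetric unit flow from a root to infinity, whose net outflow is
concentrated at the root and contributes `1 + 1` to `φ₁ (D a₁) + φ₂ (D a₂)`. The constraint is that
`c (v, w)` must be negligible against `a₁` and `a₂` at both ends, with `a₁` and `a₂` summable. On a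
graph of bounded degree such a flow would be absolutely summable, so its total divergence would be
`0`; but the flow that spreads evenly over complete bipartite graphs between levels of sizes
`16 ^ j` meets the constraint (`levelFlow`, `TensorBimodule.flowCoeff`): the flow per edge
decays like `16⁻²ʲ`, while `a₁ = 64⁻ʲ` on level `j` is summable. Taking `a₂ = ± a₁`, with the sign
alternating from level to level, makes the equations for `φ₁, φ₂` solvable.
-/

noncomputable section

open Filter Topology

/-! ### The space `ℓ¹(I)` and its predual `c₀(I)` -/

/-- The unweighted space `ℓ¹(I)` of absolutely summable complex families. -/
abbrev EllOne (I : Type*) : Type _ := lp (fun _ : I => ℂ) 1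

namespace EllOne

variable {I : Type*}

lemma summable_norm (x : EllOne I) : Summable fun i => ‖x i‖ := by
  simpa using (lp.memℓp x).summable (by simp)

lemma norm_eq (x : EllOne I) : ‖x‖ = ∑' i, ‖x i‖ := by
  simpa using lp.norm_eq_tsum_rpow (by simp) x

/-- An absolutely summable family as an element of `ℓ¹(I)`. -/
def mk (f : I → ℂ) (hf : Summable fun i => ‖f i‖) : EllOne I :=
  ⟨f, memℓp_gen (by simpa using hf)⟩

@[simp] lemma mk_apply (f : I → ℂ) (hf : Summable fun i => ‖f i‖) (i : I) : mk f hf i = f i := rfl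

/-- The unit vector of `ℓ¹(I)` at `i`. -/
def basis (i : I) : EllOne I := by classical exact lp.single 1 i 1

lemma basis_apply [DecidableEq I] (i j : I) : basis i j = if j = i then 1 else 0 := by
  by_cases h : j = i
  · subst h; simp [basis]
  · simp [basis, h]

@[simp] lemma basis_self (i : I) : basis i i = 1 := by classical simp [basis_apply]

lemma basis_ne {i j : I} (h : j ≠ i) : basis i j = 0 := by classical simp [basis_apply, h]

lemma norm_basis (i : I) : ‖basis i‖ = 1 := by
  classical simp [basis, lp.norm_single]

lemma hasSum_basis (x : EllOne I) : HasSum (fun i => x i • basis i) x := by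
  classical
  have h := lp.hasSum_single (p := 1) (by simp) x
  refine h.congr_fun fun i => ?_
  ext j
  by_cases hj : j = i
  · subst hj; simp [basis]
  · simp [basis_ne hj, hj]

lemma exists_mk (f : I → ℂ) (g : I → ℝ) (hfg : ∀ i, ‖f i‖ ≤ g i)
    {r : ℝ} (hg : HasSum g r) :
    ∃ h : Summable fun i => ‖f i‖, ‖mk f h‖ ≤ r := by
  have h := Summable.of_nonneg_of_le (fun i => norm_nonneg (f i)) hfg hg.summable
  refine ⟨h, ?_⟩
  rw [norm_eq]
  exact hasSum_le hfg h.hasSum hg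

lemma exists_functional (y : I → ℂ) {C : ℝ} (hC : 0 ≤ C)
    (hy : ∀ i, ‖y i‖ ≤ C) : ∃ φ : StrongDual ℂ (EllOne I), ∀ i, φ (basis i) = y i := by
  refine ⟨(lp.tsumCLM ℂ I ℂ).comp (lp.mapCLM 1 (fun i => y i • ContinuousLinearMap.id ℂ ℂ) hC
    fun i => ?_), fun i => ?_⟩
  · rw [norm_smul, ContinuousLinearMap.norm_id, mul_one]
    exact hy i
  · simp only [ContinuousLinearMap.comp_apply, lp.tsumCLM_apply]
    rw [tsum_eq_single i fun j hj => by simp [basis_ne hj]]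
    simp

end EllOne

section CZeroDual

variable {I : Type*} {E : Type*} [NormedAddCommGroup E] [NormedSpace ℂ E]
  (Φ : E ≃ₗᵢ[ℂ] EllOne I)

/-- The basis of `E` that an isometry `E ≃ ℓ¹(I)` carries to the unit vectors. -/
def unitVec (i : I) : E := Φ.symm (EllOne.basis i)

lemma norm_unitVec (i : I) : ‖unitVec Φ i‖ = 1 := by
  simp [unitVec, EllOne.norm_basis]

lemma hasSum_unitVec (x : E) : HasSum (fun i => Φ x i • unitVec Φ i) x := by
  simpa [unitVec] using
    (EllOne.hasSum_basis (Φ x)).mapL (Φ.symm.toContinuousLinearEquiv : EllOne I →L[ℂ] E)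

lemma mem_of_unitVec_mem {S : Submodule ℂ E} (hS : IsClosed (S : Set E))
    (h : ∀ i, unitVec Φ i ∈ S) (x : E) : x ∈ S :=
  hS.mem_of_tendsto (hasSum_unitVec Φ x)
    (Eventually.of_forall fun _ => S.sum_mem fun i _ => S.smul_mem _ (h i))

lemma hasSum_apply (φ : StrongDual ℂ E) (x : E) :
    HasSum (fun i => Φ x i * φ (unitVec Φ i)) (φ x) := by
  simpa using (hasSum_unitVec Φ x).mapL φ

lemma opNorm_le_of_unitVec (φ : StrongDual ℂ E) {C : ℝ} (hC : 0 ≤ C)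
    (h : ∀ i, ‖φ (unitVec Φ i)‖ ≤ C) : ‖φ‖ ≤ C := by
  refine φ.opNorm_le_bound hC fun x => ?_
  have hs := EllOne.summable_norm (Φ x)
  rw [← Φ.norm_map x, EllOne.norm_eq, ← tsum_mul_left]
  refine (hasSum_apply Φ φ x).norm_le_of_bounded (hs.mul_left C).hasSum fun i => ?_
  rw [norm_mul, mul_comm]
  exact mul_le_mul_of_nonneg_right (h i) (norm_nonneg _)

/-- The `i`-th coordinate of `Φ x`, as a functional of `x`. -/
def coordFunctional (i : I) : StrongDual ℂ E :=
  (lp.evalCLM ℂ (fun _ : I => ℂ) 1 i).comp (Φ.toContinuousLinearEquiv : E →L[ℂ] EllOne I)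

@[simp] lemma coordFunctional_apply (i : I) (x : E) : coordFunctional Φ i x = Φ x i := rfl

lemma coordFunctional_unitVec [DecidableEq I] (i j : I) :
    coordFunctional Φ i (unitVec Φ j) = if i = j then 1 else 0 := by
  simp [unitVec, EllOne.basis_apply]

/-- The predual `c₀(I)` of a space `E ≃ ℓ¹(I)`: the functionals whose values on the unit vectors
tend to `0`. -/
def cZeroDual : Submodule ℂ (StrongDual ℂ E) where
  carrier := {φ | Tendsto (fun i => φ (unitVec Φ i)) cofinite (𝓝 0)}
  zero_mem' := by simpa using tendsto_const_nhds
  add_mem' {φ ψ} hφ hψ := by simpa using Tendsto.add hφ hψ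
  smul_mem' c φ hφ := by simpa using Tendsto.const_mul c hφ

lemma mem_cZeroDual {φ : StrongDual ℂ E} :
    φ ∈ cZeroDual Φ ↔ Tendsto (fun i => φ (unitVec Φ i)) cofinite (𝓝 0) := Iff.rfl

lemma coordFunctional_mem (i : I) : coordFunctional Φ i ∈ cZeroDual Φ := by
  classical
  rw [mem_cZeroDual]
  refine (tendsto_const_nhds (x := (0 : ℂ))).congr' ?_
  filter_upwards [(Set.finite_singleton i).compl_mem_cofinite] with j hj
  rw [coordFunctional_unitVec, if_neg]
  exact fun h => hj h.symm

lemma isClosed_cZeroDual : IsClosed (cZeroDual Φ : Set (StrongDual ℂ E)) := by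
  refine isClosed_of_closure_subset fun φ hφ => ?_
  rw [SetLike.mem_coe, mem_cZeroDual, Metric.tendsto_nhds]
  intro ε hε
  obtain ⟨ψ, hψ, hd⟩ := Metric.mem_closure_iff.1 hφ (ε / 2) (half_pos hε)
  filter_upwards [Metric.tendsto_nhds.1 hψ (ε / 2) (half_pos hε)] with i hi
  rw [dist_zero_right] at hi ⊢
  have h1 : ‖(φ - ψ) (unitVec Φ i)‖ ≤ ‖φ - ψ‖ := by
    simpa [norm_unitVec] using (φ - ψ).le_opNorm (unitVec Φ i)
  rw [dist_eq_norm] at hd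
  calc ‖φ (unitVec Φ i)‖ = ‖(φ - ψ) (unitVec Φ i) + ψ (unitVec Φ i)‖ := by simp
    _ ≤ _ := norm_add_le _ _
    _ < ε := by linarith

lemma exists_sign (z : ℂ) : ∃ u : ℂ, ‖u‖ ≤ 1 ∧ u * z = ‖z‖ := by
  by_cases hz : z = 0
  · exact ⟨0, by simp, by simp [hz]⟩
  · have hz' : (‖z‖ : ℂ) ≠ 0 := by simpa using hz
    refine ⟨starRingEnd ℂ z / ‖z‖, ?_, ?_⟩
    · rw [norm_div]; simp [hz]
    · rw [div_mul_eq_mul_div, Complex.conj_mul']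
      field_simp

/-- A finitely supported functional has norm at most the supremum of its coefficients. -/
lemma norm_sum_coordFunctional_le (s : Finset I) (u : I → ℂ) (hu : ∀ i, ‖u i‖ ≤ 1) :
    ‖∑ i ∈ s, u i • coordFunctional Φ i‖ ≤ 1 := by
  classical
  refine opNorm_le_of_unitVec Φ _ zero_le_one fun j => ?_
  simp only [sum_apply, smul_apply,
    coordFunctional_unitVec, smul_eq_mul, mul_ite, mul_one, mul_zero, Finset.sum_ite_eq']
  split_ifs
  · exact hu j
  · simp

/-- The canonical map `E → (c₀)*` is isometric, as finitely supported functionals norm `ℓ¹`. -/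
lemma norm_le_of_cZeroDual (x : E) (C : ℝ) (h : ∀ φ ∈ cZeroDual Φ, ‖φ x‖ ≤ C * ‖φ‖)
    (hC : 0 ≤ C) : ‖x‖ ≤ C := by
  choose u hu hux using fun i => exists_sign (Φ x i)
  rw [← Φ.norm_map x, EllOne.norm_eq]
  refine Real.tsum_le_of_sum_le (fun _ => norm_nonneg _) fun s => ?_
  have h1 := h (∑ i ∈ s, u i • coordFunctional Φ i)
    (Submodule.sum_mem _ fun i _ => Submodule.smul_mem _ _ (coordFunctional_mem Φ i))
  have h2 : (∑ i ∈ s, u i • coordFunctional Φ i) x = ((∑ i ∈ s, ‖Φ x i‖ : ℝ) : ℂ) := by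
    simp [hux]
  rw [h2, Complex.norm_real, Real.norm_of_nonneg (Finset.sum_nonneg fun _ _ => norm_nonneg _)] at h1
  exact h1.trans (mul_le_of_le_one_right hC (norm_sum_coordFunctional_le Φ s u hu))

/-- The finitely supported functionals are dense in `c₀(I)`. -/
lemma hasSum_coordFunctional {φ : StrongDual ℂ E} (hφ : φ ∈ cZeroDual Φ) :
    HasSum (fun i => φ (unitVec Φ i) • coordFunctional Φ i) φ := by
  classical
  rw [HasSum, SummationFilter.unconditional_filter, Metric.tendsto_atTop]
  intro ε hε
  have h1 := Metric.tendsto_nhds.1 hφ (ε / 2) (half_pos hε)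
  rw [eventually_cofinite] at h1
  refine ⟨h1.toFinset, fun s hs => ?_⟩
  rw [dist_eq_norm]
  refine (opNorm_le_of_unitVec Φ _ (half_pos hε).le fun j => ?_).trans_lt (half_lt_self hε)
  simp only [sub_apply, sum_apply,
    smul_apply,
    coordFunctional_unitVec, smul_eq_mul, mul_ite, mul_one, mul_zero, Finset.sum_ite_eq']
  split_ifs with hj
  · simpa using (half_pos hε).le
  · have hj' : j ∉ h1.toFinset := fun h => hj (hs h)
    simp only [Set.Finite.mem_toFinset, Set.mem_ofPred_eq, not_not, dist_zero_right] at hj'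
    rw [zero_sub, norm_neg]
    exact hj'.le

/-- The canonical map `E → (c₀)*` is onto. -/
lemma exists_eval_of_cZeroDual (F : cZeroDual Φ →ₗ[ℂ] ℂ) (C : ℝ)
    (hF : ∀ φ : cZeroDual Φ, ‖F φ‖ ≤ C * ‖(φ : StrongDual ℂ E)‖) :
    ∃ x : E, ∀ φ : cZeroDual Φ, F φ = (φ : StrongDual ℂ E) x := by
  let c : I → cZeroDual Φ := fun i => ⟨coordFunctional Φ i, coordFunctional_mem Φ i⟩
  have hsum : Summable fun i => ‖F (c i)‖ := by
    choose u hu hux using fun i => exists_sign (F (c i))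
    refine summable_of_sum_le (c := max C 0) (fun _ => norm_nonneg _) fun s => ?_
    have h1 := hF (∑ i ∈ s, u i • c i)
    have h2 : F (∑ i ∈ s, u i • c i) = ((∑ i ∈ s, ‖F (c i)‖ : ℝ) : ℂ) := by
      simp [hux]
    have h3 : ((∑ i ∈ s, u i • c i : cZeroDual Φ) : StrongDual ℂ E) =
        ∑ i ∈ s, u i • coordFunctional Φ i := by simp [c]
    rw [h2, h3, Complex.norm_real,
      Real.norm_of_nonneg (Finset.sum_nonneg fun _ _ => norm_nonneg _)] at h1
    calc _ ≤ _ := h1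
      _ ≤ max C 0 * ‖∑ i ∈ s, u i • coordFunctional Φ i‖ := by gcongr; exact le_max_left _ _
      _ ≤ max C 0 := mul_le_of_le_one_right (le_max_right _ _)
        (norm_sum_coordFunctional_le Φ s u hu)
  refine ⟨Φ.symm (EllOne.mk (fun i => F (c i)) hsum), fun φ => ?_⟩
  have h1 := tendsto_iff_norm_sub_tendsto_zero.1 (hasSum_coordFunctional Φ φ.2)
  have h2 : HasSum (fun i => (φ : StrongDual ℂ E) (unitVec Φ i) * F (c i)) (F φ) := by
    refine tendsto_iff_norm_sub_tendsto_zero.2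
      (squeeze_zero (fun _ => norm_nonneg _) (fun s => ?_) (by simpa using h1.const_mul C))
    have h3 := hF (∑ i ∈ s, (φ : StrongDual ℂ E) (unitVec Φ i) • c i + (-1 : ℂ) • φ)
    rw [map_add, map_sum] at h3
    simp only [map_smul, smul_eq_mul] at h3
    have h4 : ((∑ i ∈ s, (φ : StrongDual ℂ E) (unitVec Φ i) • c i + (-1 : ℂ) • φ : cZeroDual Φ) :
        StrongDual ℂ E) =
        ∑ i ∈ s, (φ : StrongDual ℂ E) (unitVec Φ i) • coordFunctional Φ i - φ := by
      ext x
      simp [c, sub_eq_add_neg]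
    rw [h4] at h3
    simpa [sub_eq_add_neg] using h3
  have h3 := hasSum_apply Φ (φ : StrongDual ℂ E) (Φ.symm (EllOne.mk (fun i => F (c i)) hsum))
  refine h2.unique (h3.congr_fun fun i => ?_)
  simp [mul_comm]

end CZeroDual

lemma BanachBimodule.isPredual_cZeroDual {A : Type*} {E : Type*} [NonUnitalNormedRing A]
    [NormedSpace ℂ A] [NormedAddCommGroup E] [NormedSpace ℂ E] {I : Type*}
    (Φ : E ≃ₗᵢ[ℂ] EllOne I) (M : BanachBimodule A E)
    (hl : ∀ a : A, ∀ φ ∈ cZeroDual Φ, φ.comp (M.left a) ∈ cZeroDual Φ)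
    (hr : ∀ a : A, ∀ φ ∈ cZeroDual Φ, φ.comp (M.right a) ∈ cZeroDual Φ) :
    M.IsPredual (cZeroDual Φ) where
  isClosed := isClosed_cZeroDual Φ
  comp_left_mem := hl
  comp_right_mem := hr
  norm_le x C hC h := norm_le_of_cZeroDual Φ x C h hC
  exists_eval F := fun ⟨C, hC⟩ => exists_eval_of_cZeroDual Φ F C hC

/-! ### `ℓ¹(ω)` as a dual Banach algebra -/

namespace WeightedL1

variable {ω : ℕ → Set.Ici (1 : ℝ)}

@[ext] lemma ext {f g : WeightedL1 ω} (h : ∀ n, f n = g n) : f = g := Subtype.ext (funext h)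

@[simp] lemma sub_apply (f g : WeightedL1 ω) (n : ℕ) : (f - g) n = f n - g n := rfl

/-- An `ω`-summable sequence as an element of `ℓ¹(ω)`. -/
def mk (f : ℕ → ℂ) (hf : Summable fun n => ‖f n‖ * (ω n : ℝ)) : WeightedL1 ω := ⟨f, hf⟩

@[simp] lemma mk_apply (f : ℕ → ℂ) (hf : Summable fun n => ‖f n‖ * (ω n : ℝ)) (n : ℕ) :
    mk f hf n = f n := rfl

lemma weight_ne_zero (ω : ℕ → Set.Ici (1 : ℝ)) (n : ℕ) : ((ω n : ℝ) : ℂ) ≠ 0 :=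
  Complex.ofReal_ne_zero.2 (weight_pos ω n).ne'

lemma norm_weight (ω : ℕ → Set.Ici (1 : ℝ)) (n : ℕ) : ‖((ω n : ℝ) : ℂ)‖ = ω n := by
  rw [Complex.norm_real, Real.norm_of_nonneg (weight_pos ω n).le]

lemma norm_apply_le (f : WeightedL1 ω) (n : ℕ) : ‖f n‖ ≤ ‖f‖ :=
  (le_mul_of_one_le_right (norm_nonneg _) (ω n).2).trans (f.term_le_norm n)

lemma tendsto_norm_zero (f : WeightedL1 ω) : Tendsto (fun n => ‖f n‖) cofinite (𝓝 0) :=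
  squeeze_zero (fun _ => norm_nonneg _)
    (fun n => le_mul_of_one_le_right (norm_nonneg _) (ω n).2) f.summable.tendsto_cofinite_zero

variable (ω) in
/-- The isometry `f ↦ f ω` from `ℓ¹(ω)` onto `ℓ¹(ℕ)`. -/
def isometry : WeightedL1 ω ≃ₗᵢ[ℂ] EllOne ℕ where
  toFun f := EllOne.mk (fun n => f n * ((ω n : ℝ) : ℂ)) (by
    simpa only [norm_mul, norm_weight] using f.summable)
  invFun x := mk (fun n => x n / ((ω n : ℝ) : ℂ)) (by
    refine (EllOne.summable_norm x).congr fun n => ?_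
    rw [norm_div, norm_weight, div_mul_cancel₀ _ (weight_pos ω n).ne'])
  map_add' f g := by ext n; simp [add_mul]
  map_smul' c f := by ext n; simp [mul_assoc]
  left_inv f := by ext n; exact mul_div_cancel_right₀ _ (weight_ne_zero ω n)
  right_inv x := by ext n; exact div_mul_cancel₀ _ (weight_ne_zero ω n)
  norm_map' f := by
    rw [EllOne.norm_eq, norm_def]
    simp [abs_of_pos (weight_pos ω _)]

@[simp] lemma isometry_apply (f : WeightedL1 ω) (n : ℕ) :
    isometry ω f n = f n * ((ω n : ℝ) : ℂ) := rfl

lemma unitVec_isometry_apply (n m : ℕ) :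
    unitVec (isometry ω) n m = if m = n then ((ω n : ℝ) : ℂ)⁻¹ else 0 := by
  change EllOne.basis n m / ((ω m : ℝ) : ℂ) = _
  rw [EllOne.basis_apply]
  split_ifs with h
  · subst h; simp
  · simp

lemma mul_unitVec (a : WeightedL1 ω) (n : ℕ) :
    a * unitVec (isometry ω) n = a n • unitVec (isometry ω) n := by
  ext m
  by_cases h : m = n <;> simp [unitVec_isometry_apply, h]

instance : CompleteSpace (WeightedL1 ω) :=
  (completeSpace_congr (e := (isometry ω).toEquiv)
    (isometry ω).isometry.isUniformEmbedding).2 inferInstance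

variable (ω) in
lemma predual_eq_cZeroDual : predual ω = cZeroDual (isometry ω) := by
  ext φ
  rw [mem_cZeroDual, Nat.cofinite_eq_atTop]
  constructor
  · rintro ⟨w, hw, hφ⟩
    refine hw.congr fun n => ?_
    refine (HasSum.unique ?_ (hφ (unitVec (isometry ω) n)))
    have h := hasSum_ite_eq n (w n / ((ω n : ℝ) : ℂ))
    refine h.congr_fun fun m => ?_
    rw [unitVec_isometry_apply]
    split_ifs with hm
    · subst hm; field_simp
    · simp
  · intro h
    refine ⟨fun n => φ (unitVec (isometry ω) n) * ((ω n : ℝ) : ℂ), ?_, fun f => ?_⟩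
    · exact h.congr fun n => (mul_div_cancel_right₀ _ (weight_ne_zero ω n)).symm
    · refine (hasSum_apply (isometry ω) φ f).congr_fun fun n => ?_
      simp only [isometry_apply]; ring

theorem isDualBanachAlgebra (ω : ℕ → Set.Ici (1 : ℝ)) :
    IsDualBanachAlgebra (WeightedL1 ω) (predual ω) := by
  have key (a : WeightedL1 ω) (φ : StrongDual ℂ (WeightedL1 ω))
      (hφ : φ ∈ cZeroDual (isometry ω)) :
      Tendsto (fun n => φ (a * unitVec (isometry ω) n)) cofinite (𝓝 0) := by
    simp only [mul_unitVec, map_smul, smul_eq_mul]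
    refine squeeze_zero_norm (fun n => ?_) (by simpa using (hφ.norm).const_mul ‖a‖)
    rw [norm_mul]
    exact mul_le_mul_of_nonneg_right (norm_apply_le a n) (norm_nonneg _)
  refine ⟨inferInstance, ?_⟩
  rw [predual_eq_cZeroDual]
  exact BanachBimodule.isPredual_cZeroDual _ _ key fun a φ hφ => by
    rw [mem_cZeroDual]
    refine (key a φ hφ).congr fun n => ?_
    rw [mul_comm]
    rfl

lemma exists_apply_eq {V : Type*} (e : V ↪ ℕ) (f : V → ℂ)
    (hf : Summable fun v => ‖f v‖ * (ω (e v) : ℝ)) : ∃ a : WeightedL1 ω, ∀ v, a (e v) = f v := by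
  refine ⟨mk (Function.extend e f 0) ?_, fun v => e.injective.extend_apply _ _ _⟩
  refine ((hasSum_extend_zero e.injective).2 hf.hasSum).summable.congr fun n => ?_
  by_cases hn : n ∈ Set.range e
  · obtain ⟨v, rfl⟩ := hn
    simp only [e.injective.extend_apply]
  · rw [Function.extend_apply' _ _ _ hn, Function.extend_apply' _ _ _ hn]
    simp

/-- The spectral idempotent of `a ∈ ℓ¹(ω)` at `c ≠ 0`: the indicator of the finite set
`{n | a n = c}`. -/
def spectralIdempotent (a : WeightedL1 ω) {c : ℂ} (hc : c ≠ 0) : WeightedL1 ω :=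
  mk (fun n => if a n = c then 1 else 0) (by
    refine Summable.of_nonneg_of_le
      (fun n => mul_nonneg (norm_nonneg _) (weight_pos ω n).le) (fun n => ?_)
      (a.summable.mul_left ‖c‖⁻¹)
    split_ifs with h
    · rw [h, ← mul_assoc, inv_mul_cancel₀ (by simpa using hc)]; simp
    · simpa using mul_nonneg (inv_nonneg.2 (norm_nonneg c)) (a.term_nonneg n))

@[simp] lemma spectralIdempotent_apply (a : WeightedL1 ω) {c : ℂ} (hc : c ≠ 0)
    (n : ℕ) : a.spectralIdempotent hc n = if a n = c then 1 else 0 := rfl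

/-- The resolvent of `a` at `c ≠ 0` on the complement of `{n | a n = c}`: with `p` the spectral
idempotent, `(c - a) (1 + s) = c (1 - p)` for `s = a / (c - a)` off `{n | a n = c}`. As `a → 0`, the
denominators are bounded below, so `s ∈ ℓ¹(ω)`. -/
lemma exists_resolvent (a : WeightedL1 ω) {c : ℂ} (hc : c ≠ 0) :
    ∃ s : WeightedL1 ω, a + a * s - c • s = c • a.spectralIdempotent hc := by
  refine ⟨mk (fun n => if a n = c then 0 else a n / (c - a n)) ?_, ?_⟩
  · refine Summable.of_norm_bounded_eventually (a.summable.mul_left (2 / ‖c‖)) ?_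
    have hc' : 0 < ‖c‖ := norm_pos_iff.2 hc
    filter_upwards [a.tendsto_norm_zero.eventually (gt_mem_nhds (half_pos hc'))] with n hn
    rw [Real.norm_of_nonneg (mul_nonneg (norm_nonneg _) (weight_pos ω n).le), ← mul_assoc]
    refine mul_le_mul_of_nonneg_right ?_ (weight_pos ω n).le
    split_ifs with h
    · simpa using mul_nonneg (div_nonneg zero_le_two hc'.le) (norm_nonneg (a n))
    · have h1 : ‖c‖ / 2 ≤ ‖c - a n‖ := by
        have := norm_sub_norm_le c (a n)
        linarith
      rw [norm_div, div_mul_eq_mul_div, div_le_div_iff₀ (by linarith) hc']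
      nlinarith [norm_nonneg (a n)]
  · ext n
    simp only [sub_apply, add_apply, mul_apply,
      smul_apply, mk_apply, spectralIdempotent_apply]
    split_ifs with h
    · simp [h]
    · have : c - a n ≠ 0 := sub_ne_zero.2 (Ne.symm h)
      field_simp
      ring

end WeightedL1

/-! ### Pointwise approximation by commutators -/

lemma weakStarContinuous_of_comp_mem {E F : Type*} [NormedAddCommGroup E] [NormedSpace ℂ E]
    [NormedAddCommGroup F] [NormedSpace ℂ F] {P : Submodule ℂ (StrongDual ℂ E)}
    {Q : Submodule ℂ (StrongDual ℂ F)} (T : E →L[ℂ] F) (h : ∀ φ ∈ Q, φ.comp T ∈ P) :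
    WeakStarContinuous P Q T := by
  refine continuous_induced_rng.2 ?_
  refine @continuous_pi _ _ _ (weakStarTopology P) _ _ fun φ => ?_
  have h1 : @Continuous E (P → ℂ) (weakStarTopology P) _ fun x φ => (φ : StrongDual ℂ E) x :=
    continuous_induced_dom
  have h2 : Continuous fun y : P → ℂ => y ⟨_, h φ φ.2⟩ := continuous_apply _
  exact @Continuous.comp E (P → ℂ) ℂ (weakStarTopology P) _ _
    (fun x ψ => (ψ : StrongDual ℂ E) x) (fun y => y ⟨_, h φ φ.2⟩) h2 h1

namespace BanachBimodule

section Duality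

variable {A : Type*} {E : Type v} [NonUnitalNormedRing A] [NormedSpace ℂ A]
  [NormedAddCommGroup E] [NormedSpace ℂ E]

lemma tendsto_weakStar_iff {P : Submodule ℂ (StrongDual ℂ E)} {ι : Type*} {l : Filter ι}
    {x : ι → E} {y : E} :
    Tendsto x l (@nhds E (weakStarTopology P) y) ↔
      ∀ φ ∈ P, Tendsto (fun i => φ (x i)) l (𝓝 (φ y)) := by
  rw [nhds_induced, tendsto_comap_iff, tendsto_pi_nhds]
  exact Subtype.forall

/-- Finite-dimensional duality: if every `φ ∈ P` that vanishes on all commutators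
`a₀ · x - x · a₀` vanishes at `D a₀`, then on each finite subset of `P` the vector `D a₀` agrees
with some commutator. -/
lemma isWeakStarApproxInnerAt_of_forall (M : BanachBimodule A E)
    (P : Submodule ℂ (StrongDual ℂ E)) (D : A →L[ℂ] E) (a₀ : A)
    (h : ∀ φ ∈ P, (∀ x, φ (M.left a₀ x) = φ (M.right a₀ x)) → φ (D a₀) = 0) :
    M.IsWeakStarApproxInnerAt P D a₀ := by
  have key (s : Finset P) : ∃ x : E, ∀ φ ∈ s,
      (φ : StrongDual ℂ E) (M.left a₀ x - M.right a₀ x) = (φ : StrongDual ℂ E) (D a₀) := by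
    let ev : E →ₗ[ℂ] (s → ℂ) := LinearMap.pi fun φ => ((φ : P) : StrongDual ℂ E).toLinearMap
    let T : E →ₗ[ℂ] (s → ℂ) := ev ∘ₗ (M.left a₀ - M.right a₀).toLinearMap
    by_cases hD : ev (D a₀) ∈ LinearMap.range T
    · obtain ⟨x, hx⟩ := hD
      exact ⟨x, fun φ hφ => congrFun hx ⟨φ, hφ⟩⟩
    · classical
      obtain ⟨f, hf, hker⟩ := Submodule.exists_le_ker_of_notMem hD
      exfalso
      let ψ : StrongDual ℂ E :=
        ∑ φ : s, f (fun j => if φ = j then 1 else 0) • ((φ : P) : StrongDual ℂ E)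
      have hψ (x : E) : ψ x = f (ev x) := by
        rw [LinearMap.pi_apply_eq_sum_univ f]
        simp [ψ, ev, mul_comm]
      refine hf ((hψ _).symm.trans (h ψ ?_ fun x => ?_))
      · exact Submodule.sum_mem _ fun φ _ => Submodule.smul_mem _ _ (φ : P).2
      · have := hker ⟨x, rfl⟩
        rw [← sub_eq_zero, ← map_sub, hψ]
        exact this
  choose x hx using key
  refine ⟨Finset P, inferInstance, inferInstance, inferInstance, x, ?_⟩
  rw [tendsto_weakStar_iff]
  intro φ hφ
  refine (tendsto_const_nhds (x := φ (D a₀))).congr' ?_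
  filter_upwards [eventually_ge_atTop {⟨φ, hφ⟩}] with s hs
  exact (hx s _ (hs (Finset.mem_singleton_self _))).symm

/-- If `(φ₁, φ₂)` kills all pairs of commutators of `a₁` and `a₂` with a common `x`, but not
`(D a₁, D a₂)`, then no net of inner derivations tends to `D` at `a₁` and `a₂` at once. -/
lemma not_isWeakStarApproxInner (M : BanachBimodule A E) {P : Submodule ℂ (StrongDual ℂ E)}
    {D : A →L[ℂ] E} {φ₁ φ₂ : StrongDual ℂ E} (h₁ : φ₁ ∈ P) (h₂ : φ₂ ∈ P) (a₁ a₂ : A)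
    (h : ∀ x, φ₁ (M.left a₁ x - M.right a₁ x) + φ₂ (M.left a₂ x - M.right a₂ x) = 0)
    (hD : φ₁ (D a₁) + φ₂ (D a₂) ≠ 0) : ¬ M.IsWeakStarApproxInner P D := by
  rintro ⟨ι, _, _, _, x, hx⟩
  have h3 := (tendsto_weakStar_iff.1 (hx a₁) φ₁ h₁).add
    (tendsto_weakStar_iff.1 (hx a₂) φ₂ h₂)
  simp only [h] at h3
  exact hD (tendsto_nhds_unique h3 tendsto_const_nhds)

end Duality

section Spectral

variable {ω : ℕ → Set.Ici (1 : ℝ)} {E : Type v} [NormedAddCommGroup E] [NormedSpace ℂ E]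

variable (M : BanachBimodule (WeightedL1 ω) E)

/-- If `φ` vanishes on commutators with `a`, then it vanishes on the vectors `z` on which `a` acts
from the right by `c`, and from the left away from its eigenvalue `c`: with `s` the resolvent, such
a `z` is, up to the factor `-c`, the commutator of `a` with `z + s · z`. -/
lemma apply_eq_zero_of_left (a : WeightedL1 ω) {c : ℂ} (hc : c ≠ 0) (φ : StrongDual ℂ E)
    (h : ∀ x, φ (M.left a x) = φ (M.right a x)) {z : E}
    (hz : M.left (a.spectralIdempotent hc) z = 0) (hza : M.right a z = c • z) : φ z = 0 := by
  obtain ⟨s, hs⟩ := a.exists_resolvent hc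
  have h1 := h (z + M.left s z)
  have h2 : M.left a z + M.left a (M.left s z) - c • M.left s z = 0 := by
    have := congrArg (fun b => M.left b z) hs
    simpa [hz, M.left_mul] using this
  have h3 : φ (M.left a (z + M.left s z)) = c * φ (M.left s z) := by
    rw [map_add, sub_eq_zero.1 h2, map_smul, smul_eq_mul]
  rw [h3, map_add, ← M.left_right, hza, map_smul] at h1
  simp only [map_add, map_smul, smul_eq_mul] at h1
  have h4 : c * φ z = 0 := by linear_combination -h1
  exact (mul_eq_zero.1 h4).resolve_left hc

/-- Mirror image of `apply_eq_zero_of_left`. -/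
lemma apply_eq_zero_of_right (a : WeightedL1 ω) {c : ℂ} (hc : c ≠ 0) (φ : StrongDual ℂ E)
    (h : ∀ x, φ (M.left a x) = φ (M.right a x)) {z : E}
    (hz : M.right (a.spectralIdempotent hc) z = 0) (hza : M.left a z = c • z) : φ z = 0 := by
  obtain ⟨s, hs⟩ := a.exists_resolvent hc
  have h1 := h (z + M.right s z)
  have h2 : M.right a z + M.right a (M.right s z) - c • M.right s z = 0 := by
    have := congrArg (fun b => M.right b z) hs
    rw [mul_comm a s] at this
    simpa [hz, M.right_mul] using this
  have h3 : φ (M.right a (z + M.right s z)) = c * φ (M.right s z) := by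
    rw [map_add, sub_eq_zero.1 h2, map_smul, smul_eq_mul]
  rw [h3, map_add, M.left_right, hza, map_smul] at h1
  simp only [map_add, map_smul, smul_eq_mul] at h1
  have h4 : c * φ z = 0 := by linear_combination h1
  exact (mul_eq_zero.1 h4).resolve_left hc

/-- For an idempotent `p`, `D p = D p · p + p · D p` and `p · D p · p = 0`, so both summands are
off-diagonal for `p`. -/
lemma IsDerivation.apply_spectralIdempotent {D : WeightedL1 ω →L[ℂ] E} (hD : M.IsDerivation D)
    (a : WeightedL1 ω) {c : ℂ} (hc : c ≠ 0) (φ : StrongDual ℂ E)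
    (h : ∀ x, φ (M.left a x) = φ (M.right a x)) : φ (D (a.spectralIdempotent hc)) = 0 := by
  set p := a.spectralIdempotent hc with hp
  have hpp : p * p = p := by ext n; simp [hp]
  have hap : a * p = c • p := by
    ext n
    by_cases hn : a n = c <;> simp [hp, hn]
  have hpa : p * a = c • p := by rw [mul_comm, hap]
  have h1 : D p = M.right p (D p) + M.left p (D p) := by
    conv_lhs => rw [← hpp]
    exact hD p p
  have hl (x : E) : M.left p (M.left p x) = M.left p x := by rw [← M.left_mul, hpp]
  have h2 : M.left p (M.right p (D p)) = 0 := by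
    have := congrArg (M.left p) h1
    rw [map_add, hl] at this
    exact right_eq_add.1 this
  rw [h1, map_add,
    M.apply_eq_zero_of_left a hc φ h h2 (by rw [← M.right_mul, hpa]; simp),
    M.apply_eq_zero_of_right a hc φ h (by rw [← M.left_right, h2])
      (by rw [← M.left_mul, hap]; simp), add_zero]

/-- Sum `φ (D a) = ∑ a n φ (D e_n)` over the level sets of `a`; the level set of `c ≠ 0` contributes
`c φ (D p)` with `p` the spectral idempotent at `c`. -/
lemma IsDerivation.apply_eq_zero {D : WeightedL1 ω →L[ℂ] E} (hD : M.IsDerivation D)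
    (a : WeightedL1 ω) (φ : StrongDual ℂ E)
    (h : ∀ x, φ (M.left a x) = φ (M.right a x)) : φ (D a) = 0 := by
  let Φ := WeightedL1.isometry ω
  have hs := hasSum_apply Φ (φ.comp D) a
  refine (hs.tsum_fiberwise (fun n => a n)).unique ?_
  convert hasSum_zero with c
  by_cases hc : c = 0
  · convert tsum_zero with n
    have hn : a n = c := n.2
    simp [Φ, hn, hc]
  · have hp := hasSum_apply Φ (φ.comp D) (a.spectralIdempotent hc)
    have h0 := hD.apply_spectralIdempotent M a hc φ h
    rw [ContinuousLinearMap.comp_apply, h0] at hp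
    rw [tsum_subtype ((fun n => a n) ⁻¹' {c})
      (fun n => Φ a n * (φ.comp D) (unitVec Φ n))]
    refine ((hp.mul_left c).congr_fun fun n => ?_).tsum_eq.trans (mul_zero c)
    by_cases hn : a n = c
    · simp [Φ, hn, mul_assoc]
    · simp [Φ, hn]

end Spectral

end BanachBimodule

theorem WeightedL1.isPointwiseWeakStarApproxConnesAmenable (ω : ℕ → Set.Ici (1 : ℝ)) :
    IsPointwiseWeakStarApproxConnesAmenable.{0, v} (WeightedL1 ω) (WeightedL1.predual ω) := by
  intro a₀ E _ _ _ M P _ _ D hD _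
  exact M.isWeakStarApproxInnerAt_of_forall P D a₀ fun φ _ h => hD.apply_eq_zero M a₀ φ h

/-! ### A derivation into a bimodule of tensors -/

lemma tendsto_cofinite_of_injective {V W X : Type*} {e : V → W} {F : W → X}
    {l : Filter X} {x : X} (hx : pure x ≤ l) (h0 : ∀ n, n ∉ Set.range e → F n = x)
    (h : Tendsto (fun v => F (e v)) cofinite l) : Tendsto F cofinite l := by
  intro U hU
  refine mem_cofinite.2 (((mem_cofinite.1 (h hU)).image e).subset fun n hn => ?_)
  by_cases hr : n ∈ Set.range e
  · obtain ⟨v, rfl⟩ := hr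
    exact ⟨v, hn, rfl⟩
  · refine absurd ?_ hn
    rw [Set.mem_preimage, h0 n hr]
    exact hx hU

/-- Index set of the basis of a bimodule spanned by the elementary tensors `v ⊗ w` (`pair v w`),
`v ⊗ 1` (`row v`) and `1 ⊗ w` (`col w`), where `1` is an adjoined identity. -/
inductive TensorIndex (V : Type*) : Type _
  | pair (v w : V)
  | row (v : V)
  | col (w : V)

namespace TensorIndex

variable {V : Type*}

/-- The flip of the two tensor factors. -/
def swap : TensorIndex V → TensorIndex V
  | pair v w => pair w v
  | row v => col v
  | col w => row w

@[simp] lemma swap_pair (v w : V) : swap (pair v w) = pair w v := rfl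
@[simp] lemma swap_row (v : V) : swap (row v) = col v := rfl
@[simp] lemma swap_col (v : V) : swap (col v) = row v := rfl

lemma swap_involutive : Function.Involutive (swap (V := V)) := by rintro (_ | _ | _) <;> rfl

lemma pair_injective : Function.Injective fun p : V × V => pair p.1 p.2 := by
  rintro ⟨v, w⟩ ⟨v', w'⟩ h
  simpa using h

lemma row_injective : Function.Injective (row (V := V)) := fun _ _ h => by simpa using h

lemma col_injective : Function.Injective (col (V := V)) := fun _ _ h => by simpa using h

lemma tendsto_cofinite {X : Type*} {f : TensorIndex V → X} {l : Filter X}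
    (hp : Tendsto (fun p : V × V => f (pair p.1 p.2)) cofinite l)
    (hr : Tendsto (fun v => f (row v)) cofinite l) (hc : Tendsto (fun v => f (col v)) cofinite l) :
    Tendsto f cofinite l := by
  intro U hU
  have h1 := (mem_cofinite.1 (hp hU)).image fun p : V × V => pair p.1 p.2
  have h2 := (mem_cofinite.1 (hr hU)).image row
  have h3 := (mem_cofinite.1 (hc hU)).image col
  refine mem_cofinite.2 (((h1.union h2).union h3).subset ?_)
  rintro (⟨v, w⟩ | v | w) hi
  · exact Or.inl (Or.inl ⟨(v, w), hi, rfl⟩)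
  · exact Or.inl (Or.inr ⟨v, hi, rfl⟩)
  · exact Or.inr ⟨w, hi, rfl⟩

end TensorIndex

namespace TensorBimodule

open TensorIndex

variable {ω : ℕ → Set.Ici (1 : ℝ)} {V : Type v} (e : V ↪ ℕ)

/-- Restriction along `e` maps `ℓ¹(ω)` contractively to `ℓ¹(V)`, once the weight is absorbed. -/
lemma exists_restrict (a : WeightedL1 ω) :
    ∃ h : Summable fun v => ‖a (e v) * ((ω (e v) : ℝ) : ℂ)‖,
      ‖EllOne.mk (fun v => a (e v) * ((ω (e v) : ℝ) : ℂ)) h‖ ≤ ‖a‖ := by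
  have h : Summable fun v => ‖a (e v) * ((ω (e v) : ℝ) : ℂ)‖ := by
    simp only [norm_mul, WeightedL1.norm_weight]
    exact a.summable.comp_injective e.injective
  refine ⟨h, ?_⟩
  rw [EllOne.norm_eq, WeightedL1.norm_def]
  simp only [EllOne.mk_apply, norm_mul, WeightedL1.norm_weight]
  exact tsum_comp_le_tsum_of_inj a.summable a.term_nonneg e.injective

/-- Coordinates of `a · x`, from `a · (v ⊗ t) = a v (v ⊗ t)` for `t ∈ V ∪ {1}` and
`a · (1 ⊗ w) = a ⊗ w = ∑ v, a v (v ⊗ w)`. The factors `v` are divided by their weights to give unit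
vectors, whence the weight in the second rule. -/
def leftFun (a : WeightedL1 ω) (x : EllOne (TensorIndex V)) : TensorIndex V → ℂ
  | pair v w => a (e v) * x (pair v w) + a (e v) * ((ω (e v) : ℝ) : ℂ) * x (col w)
  | row v => a (e v) * x (row v)
  | col _ => 0

lemma exists_leftFun (a : WeightedL1 ω) (x : EllOne (TensorIndex V)) :
    ∃ h : Summable fun i => ‖leftFun e a x i‖, ‖EllOne.mk (leftFun e a x) h‖ ≤ 2 * ‖a‖ * ‖x‖ := by
  obtain ⟨hb, hba⟩ := exists_restrict e a
  have hx := EllOne.summable_norm x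
  have hxc : Summable fun w => ‖x (col w)‖ := hx.comp_injective col_injective
  have h2 := hb.hasSum.mul hxc.hasSum
    (hb.mul_of_nonneg hxc (fun _ => norm_nonneg _) fun _ => norm_nonneg _)
  have h3 := (hasSum_extend_zero pair_injective).2 h2
  have h4 (i : TensorIndex V) : ‖leftFun e a x i‖ ≤ ‖a‖ * ‖x i‖ +
      Function.extend (fun p : V × V => pair p.1 p.2)
        (fun p => ‖a (e p.1) * ((ω (e p.1) : ℝ) : ℂ)‖ * ‖x (col p.2)‖) 0 i := by
    rcases i with ⟨v, w⟩ | v | w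
    · have := pair_injective.extend_apply (fun p : V × V =>
        ‖a (e p.1) * ((ω (e p.1) : ℝ) : ℂ)‖ * ‖x (col p.2)‖) 0 (v, w)
      dsimp only at this
      rw [this]
      refine (norm_add_le _ _).trans ?_
      rw [norm_mul (a (e v)), norm_mul _ (x (col w))]
      gcongr
      exact a.norm_apply_le _
    · rw [Function.extend_apply' _ _ _ (by simp)]
      simpa [leftFun] using mul_le_mul_of_nonneg_right (a.norm_apply_le (e v)) (norm_nonneg _)
    · rw [Function.extend_apply' _ _ _ (by simp)]
      simpa [leftFun] using mul_nonneg (norm_nonneg a) (norm_nonneg _)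
  obtain ⟨h, hle⟩ := EllOne.exists_mk _ _ h4 ((hx.hasSum.mul_left ‖a‖).add h3)
  refine ⟨h, hle.trans ?_⟩
  rw [← EllOne.norm_eq x]
  have h5 : ∑' w, ‖x (col w)‖ ≤ ‖x‖ := by
    rw [EllOne.norm_eq]
    exact tsum_comp_le_tsum_of_inj hx (fun _ => norm_nonneg _) col_injective
  have h6 : ∑' v, ‖a (e v) * ((ω (e v) : ℝ) : ℂ)‖ ≤ ‖a‖ := by
    simpa [EllOne.norm_eq] using hba
  have := mul_le_mul h6 h5 (tsum_nonneg fun _ => norm_nonneg _) (norm_nonneg a)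
  linarith

/-- The left action. -/
def left : WeightedL1 ω →L[ℂ] EllOne (TensorIndex V) →L[ℂ] EllOne (TensorIndex V) :=
  LinearMap.mkContinuous₂
    (LinearMap.mk₂ ℂ (fun a x => EllOne.mk (leftFun e a x) (exists_leftFun e a x).1)
      (fun a b x => by ext (⟨v, w⟩ | v | w) <;> simp [leftFun] <;> ring)
      (fun c a x => by ext (⟨v, w⟩ | v | w) <;> simp [leftFun] <;> ring)
      (fun a x y => by ext (⟨v, w⟩ | v | w) <;> simp [leftFun] <;> ring)
      (fun c a x => by ext (⟨v, w⟩ | v | w) <;> simp [leftFun] <;> ring))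
    2 fun a x => (exists_leftFun e a x).2

@[simp] lemma left_pair (a : WeightedL1 ω) (x : EllOne (TensorIndex V)) (v w : V) :
    left e a x (pair v w) =
      a (e v) * x (pair v w) + a (e v) * ((ω (e v) : ℝ) : ℂ) * x (col w) := rfl

@[simp] lemma left_row (a : WeightedL1 ω) (x : EllOne (TensorIndex V)) (v : V) :
    left e a x (row v) = a (e v) * x (row v) := rfl

@[simp] lemma left_col (a : WeightedL1 ω) (x : EllOne (TensorIndex V)) (w : V) :
    left e a x (col w) = 0 := rfl

/-- The flip of the two tensor factors, on `ℓ¹`. -/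
def flip : EllOne (TensorIndex V) →L[ℂ] EllOne (TensorIndex V) :=
  LinearMap.mkContinuous
    { toFun x := EllOne.mk (fun i => x i.swap)
        ((EllOne.summable_norm x).comp_injective swap_involutive.injective)
      map_add' x y := by ext i; simp
      map_smul' c x := by ext i; simp }
    1 fun x => by
      rw [one_mul, EllOne.norm_eq, EllOne.norm_eq]
      exact (swap_involutive.toPerm.tsum_eq fun i => ‖x i‖).le

@[simp] lemma flip_apply (x : EllOne (TensorIndex V)) (i : TensorIndex V) :
    flip x i = x i.swap := rfl

lemma flip_basis (i : TensorIndex V) : flip (EllOne.basis i) = EllOne.basis i.swap := by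
  classical
  ext j
  simp only [flip_apply, EllOne.basis_apply, swap_involutive.eq_iff]

/-- The right action, mirror image of the left one. -/
def right : WeightedL1 ω →L[ℂ] EllOne (TensorIndex V) →L[ℂ] EllOne (TensorIndex V) :=
  (ContinuousLinearMap.compL ℂ _ _ _ flip).comp
    (((ContinuousLinearMap.compL ℂ _ _ _).flip flip).comp (left e))

lemma right_apply (a : WeightedL1 ω) (x : EllOne (TensorIndex V)) :
    right e a x = flip (left e a (flip x)) := rfl

@[simp] lemma right_pair (a : WeightedL1 ω) (x : EllOne (TensorIndex V)) (v w : V) :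
    right e a x (pair v w) =
      a (e w) * x (pair v w) + a (e w) * ((ω (e w) : ℝ) : ℂ) * x (row v) := rfl

@[simp] lemma right_row (a : WeightedL1 ω) (x : EllOne (TensorIndex V)) (v : V) :
    right e a x (row v) = 0 := rfl

@[simp] lemma right_col (a : WeightedL1 ω) (x : EllOne (TensorIndex V)) (w : V) :
    right e a x (col w) = a (e w) * x (col w) := rfl

variable (ω) in
/-- The sub-bimodule `A ⊗ A + A ⊗ 1 + 1 ⊗ A` of `A♯ ⊗ A♯` (projective tensor product), for `A` the
restriction of `ℓ¹(ω)` to the range of `e : V ↪ ℕ` and `A♯` its unitization, in normalized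
coordinates. It does not contain `1 ⊗ 1`. -/
def bimodule : BanachBimodule (WeightedL1 ω) (EllOne (TensorIndex V)) where
  left := left e
  right := right e
  left_mul a b x := by ext (⟨v, w⟩ | v | w) <;> simp <;> ring
  right_mul a b x := by ext (⟨v, w⟩ | v | w) <;> simp <;> ring
  left_right a b x := by
    ext (⟨v, w⟩ | v | w)
    · simp
      ring
    · simp
    · simp

/-- Coordinates of `a ⊗ 1 - 1 ⊗ a`. -/
def derivationFun (a : WeightedL1 ω) : TensorIndex V → ℂ
  | pair _ _ => 0
  | row v => a (e v) * ((ω (e v) : ℝ) : ℂ)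
  | col v => -(a (e v) * ((ω (e v) : ℝ) : ℂ))

lemma exists_derivationFun (a : WeightedL1 ω) :
    ∃ h : Summable fun i => ‖derivationFun e a i‖,
      ‖EllOne.mk (derivationFun e a) h‖ ≤ 2 * ‖a‖ := by
  obtain ⟨hb, hba⟩ := exists_restrict e a
  have h1 := (hasSum_extend_zero row_injective).2 hb.hasSum
  have h2 := (hasSum_extend_zero col_injective).2 hb.hasSum
  have h4 (i : TensorIndex V) : ‖derivationFun e a i‖ ≤
      Function.extend row (fun v => ‖a (e v) * ((ω (e v) : ℝ) : ℂ)‖) 0 i +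
      Function.extend col (fun v => ‖a (e v) * ((ω (e v) : ℝ) : ℂ)‖) 0 i := by
    rcases i with ⟨v, w⟩ | v | w
    · rw [Function.extend_apply' _ _ _ (by simp), Function.extend_apply' _ _ _ (by simp)]
      simp [derivationFun]
    · rw [row_injective.extend_apply, Function.extend_apply' _ _ _ (by simp)]
      simp [derivationFun]
    · rw [col_injective.extend_apply, Function.extend_apply' _ _ _ (by simp)]
      simp [derivationFun]
  obtain ⟨h, hle⟩ := EllOne.exists_mk _ _ h4 (h1.add h2)
  refine ⟨h, hle.trans ?_⟩
  have h6 : ∑' v, ‖a (e v) * ((ω (e v) : ℝ) : ℂ)‖ ≤ ‖a‖ := by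
    simpa [EllOne.norm_eq] using hba
  linarith

variable (ω) in
/-- The derivation `a ↦ a ⊗ 1 - 1 ⊗ a`: in `A♯ ⊗ A♯` it is implemented by `1 ⊗ 1`, which the
bimodule lacks. -/
def derivation : WeightedL1 ω →L[ℂ] EllOne (TensorIndex V) :=
  LinearMap.mkContinuous
    { toFun a := EllOne.mk (derivationFun e a) (exists_derivationFun e a).1
      map_add' a b := by ext (⟨v, w⟩ | v | w) <;> simp [derivationFun] <;> ring
      map_smul' c a := by ext (⟨v, w⟩ | v | w) <;> simp [derivationFun] <;> ring }
    2 fun a => (exists_derivationFun e a).2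

@[simp] lemma derivation_pair (a : WeightedL1 ω) (v w : V) :
    derivation ω e a (pair v w) = 0 := rfl

@[simp] lemma derivation_row (a : WeightedL1 ω) (v : V) :
    derivation ω e a (row v) = a (e v) * ((ω (e v) : ℝ) : ℂ) := rfl

@[simp] lemma derivation_col (a : WeightedL1 ω) (v : V) :
    derivation ω e a (col v) = -(a (e v) * ((ω (e v) : ℝ) : ℂ)) := rfl

lemma isDerivation_derivation : (bimodule ω e).IsDerivation (derivation ω e) := fun a b => by
  ext (⟨v, w⟩ | v | w) <;> simp [bimodule] <;> ring

end TensorBimodule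

/-! ### Duality and normality of the bimodule of tensors -/

namespace TensorBimodule

open TensorIndex

variable {ω : ℕ → Set.Ici (1 : ℝ)} {V : Type v} (e : V ↪ ℕ)

variable (V) in
/-- The predual `c₀` of the bimodule. -/
abbrev predual : Submodule ℂ (StrongDual ℂ (EllOne (TensorIndex V))) :=
  cZeroDual (LinearIsometryEquiv.refl ℂ (EllOne (TensorIndex V)))

lemma mem_predual {φ : StrongDual ℂ (EllOne (TensorIndex V))} :
    φ ∈ predual V ↔ Tendsto (fun i => φ (EllOne.basis i)) cofinite (𝓝 0) := Iff.rfl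

lemma left_basis_pair (a : WeightedL1 ω) (v w : V) :
    left e a (EllOne.basis (pair v w)) = a (e v) • EllOne.basis (pair v w) := by
  classical
  ext (⟨v', w'⟩ | v' | w') <;> simp [EllOne.basis_apply]
  split_ifs with h
  · rw [h.1]
  · rfl

lemma left_basis_row (a : WeightedL1 ω) (v : V) :
    left e a (EllOne.basis (row v)) = a (e v) • EllOne.basis (row v) := by
  classical
  ext (⟨v', w'⟩ | v' | w') <;> simp [EllOne.basis_apply]
  split_ifs with h
  · rw [h]
  · rfl

lemma left_unitVec_basis_col (v w : V) :
    left e (unitVec (WeightedL1.isometry ω) (e v)) (EllOne.basis (col w)) =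
      EllOne.basis (pair v w) := by
  classical
  ext (⟨v', w'⟩ | v' | w')
  · by_cases hv : v' = v <;> by_cases hw : w' = w <;>
      simp [EllOne.basis_apply, WeightedL1.unitVec_isometry_apply, hv, hw,
        inv_mul_cancel₀ (WeightedL1.weight_ne_zero ω (e v))]
  · simp [EllOne.basis_apply]
  · simp [EllOne.basis_apply]

lemma unitVec_apply_of_notMem_range {n : ℕ} (hn : n ∉ Set.range e) (v : V) :
    unitVec (WeightedL1.isometry ω) n (e v) = 0 := by
  rw [WeightedL1.unitVec_isometry_apply, if_neg]
  rintro rfl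
  exact hn ⟨v, rfl⟩

lemma left_unitVec_of_notMem_range {n : ℕ} (hn : n ∉ Set.range e) (x : EllOne (TensorIndex V)) :
    left e (unitVec (WeightedL1.isometry ω) n) x = 0 := by
  ext (⟨v', w'⟩ | v' | w') <;> simp [unitVec_apply_of_notMem_range e hn]

/-- The left action preserves the predual. As the predual is closed, it is enough to let a unit
vector of `ℓ¹(ω)` act. -/
lemma comp_left_mem (a : WeightedL1 ω) {φ : StrongDual ℂ (EllOne (TensorIndex V))}
    (hφ : φ ∈ predual V) : φ.comp (left e a) ∈ predual V := by
  let L : WeightedL1 ω →L[ℂ] StrongDual ℂ (EllOne (TensorIndex V)) :=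
    (ContinuousLinearMap.compL ℂ _ _ _ φ).comp (left e)
  refine mem_of_unitVec_mem (WeightedL1.isometry ω) (S := (predual V).comap L.toLinearMap)
    ((isClosed_cZeroDual _).preimage L.continuous) (fun n => ?_) a
  change φ.comp (left e (unitVec (WeightedL1.isometry ω) n)) ∈ predual V
  set u := unitVec (WeightedL1.isometry ω) n with hu
  have small {J : Type v} (f : J → ℂ) (τ : J → TensorIndex V) (hτ : Function.Injective τ)
      (hf : ∀ j, ‖f j‖ ≤ ‖u‖ * ‖φ (EllOne.basis (τ j))‖) : Tendsto f cofinite (𝓝 0) :=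
    squeeze_zero_norm hf
      (by simpa using ((mem_predual.1 hφ).comp hτ.tendsto_cofinite).norm.const_mul ‖u‖)
  rw [mem_predual]
  refine TensorIndex.tendsto_cofinite ?_ ?_ ?_
  · refine small _ _ pair_injective fun p => ?_
    rw [ContinuousLinearMap.comp_apply, left_basis_pair, map_smul, norm_smul]
    exact mul_le_mul_of_nonneg_right (u.norm_apply_le _) (norm_nonneg _)
  · refine small _ _ row_injective fun v => ?_
    rw [ContinuousLinearMap.comp_apply, left_basis_row, map_smul, norm_smul]
    exact mul_le_mul_of_nonneg_right (u.norm_apply_le _) (norm_nonneg _)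
  · by_cases hn : n ∈ Set.range e
    · obtain ⟨v, rfl⟩ := hn
      have hinj : Function.Injective fun w => pair v w := fun w w' h => by simpa using h
      refine ((mem_predual.1 hφ).comp hinj.tendsto_cofinite).congr fun w => ?_
      simp only [ContinuousLinearMap.comp_apply, Function.comp_apply, hu, left_unitVec_basis_col]
    · simpa [hu, left_unitVec_of_notMem_range e hn] using tendsto_const_nhds

lemma comp_flip_mem {φ : StrongDual ℂ (EllOne (TensorIndex V))} (hφ : φ ∈ predual V) :
    φ.comp flip ∈ predual V := by
  rw [mem_predual] at *
  refine (hφ.comp swap_involutive.injective.tendsto_cofinite).congr fun i => ?_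
  simp only [ContinuousLinearMap.comp_apply, Function.comp_apply, flip_basis]

lemma comp_right_mem (a : WeightedL1 ω) {φ : StrongDual ℂ (EllOne (TensorIndex V))}
    (hφ : φ ∈ predual V) : φ.comp (right e a) ∈ predual V := by
  have h : φ.comp (right e a) = ((φ.comp flip).comp (left e a)).comp flip := by
    ext x
    simp only [ContinuousLinearMap.comp_apply, right_apply]
  rw [h]
  exact comp_flip_mem (comp_left_mem e a (comp_flip_mem hφ))

variable (ω) in
lemma isPredual : (bimodule ω e).IsPredual (predual V) :=
  BanachBimodule.isPredual_cZeroDual (LinearIsometryEquiv.refl ℂ (EllOne (TensorIndex V)))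
    (bimodule ω e) (fun a _ hφ => comp_left_mem e a hφ) fun a _ hφ => comp_right_mem e a hφ

/-- Normality of the left action. As `c₀(ω⁻¹)` is closed, it is enough to act on unit vectors. -/
lemma comp_left_flip_mem (x : EllOne (TensorIndex V))
    {φ : StrongDual ℂ (EllOne (TensorIndex V))} (hφ : φ ∈ predual V) :
    φ.comp ((left e).flip x) ∈ WeightedL1.predual ω := by
  rw [WeightedL1.predual_eq_cZeroDual]
  let L : EllOne (TensorIndex V) →L[ℂ] StrongDual ℂ (WeightedL1 ω) :=
    (ContinuousLinearMap.compL ℂ _ _ _ φ).comp (left e).flip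
  refine mem_of_unitVec_mem (LinearIsometryEquiv.refl ℂ _)
    (S := (cZeroDual (WeightedL1.isometry ω)).comap L.toLinearMap)
    ((isClosed_cZeroDual _).preimage L.continuous) (fun i => ?_) x
  change Tendsto (fun n => φ (left e (unitVec (WeightedL1.isometry ω) n) (EllOne.basis i)))
    cofinite (𝓝 0)
  have diag (v : V) (c : ℂ) :
      Tendsto (fun n => (unitVec (WeightedL1.isometry ω) n) (e v) • c) cofinite (𝓝 0) := by
    refine (tendsto_const_nhds (x := (0 : ℂ))).congr' ?_
    filter_upwards [(Set.finite_singleton (e v)).compl_mem_cofinite] with n hn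
    rw [WeightedL1.unitVec_isometry_apply, if_neg fun h => hn h.symm, zero_smul]
  rcases i with ⟨v, w⟩ | v | w
  · simpa only [left_basis_pair, map_smul] using diag v _
  · simpa only [left_basis_row, map_smul] using diag v _
  · refine tendsto_cofinite_of_injective (pure_le_nhds 0) (fun n hn => ?_) (e := e) ?_
    · rw [left_unitVec_of_notMem_range e hn, map_zero]
    · have hinj : Function.Injective fun v => pair v w := fun v v' h => by simpa using h
      refine ((mem_predual.1 hφ).comp hinj.tendsto_cofinite).congr fun v => ?_
      simp only [Function.comp_apply, left_unitVec_basis_col]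

variable (ω) in
lemma isNormal : (bimodule ω e).IsNormal (WeightedL1.predual ω) (predual V) where
  left x := weakStarContinuous_of_comp_mem ((left e).flip x) fun _ hφ =>
    comp_left_flip_mem e x hφ
  right x := weakStarContinuous_of_comp_mem ((right e).flip x) fun φ hφ => by
    have h : φ.comp ((right (ω := ω) e).flip x) = 
        (φ.comp flip).comp ((left e).flip (flip x)) := by
      ext a
      simp only [ContinuousLinearMap.comp_apply, ContinuousLinearMap.flip_apply, right_apply]
    rw [h]
    exact comp_left_flip_mem e (flip x) (comp_flip_mem hφ)

lemma derivation_unitVec (v : V) : derivation ω e (unitVec (WeightedL1.isometry ω) (e v)) =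
    EllOne.basis (row v) - EllOne.basis (col v) := by
  classical
  ext (⟨v', w'⟩ | v' | w')
  · simp [EllOne.basis_apply]
  · by_cases hv : v' = v <;>
      simp [EllOne.basis_apply, WeightedL1.unitVec_isometry_apply, hv,
        inv_mul_cancel₀ (WeightedL1.weight_ne_zero ω (e v))]
  · by_cases hv : w' = v <;>
      simp [EllOne.basis_apply, WeightedL1.unitVec_isometry_apply, hv,
        inv_mul_cancel₀ (WeightedL1.weight_ne_zero ω (e v))]

variable (ω) in
lemma weakStarContinuous_derivation :
    WeakStarContinuous (WeightedL1.predual ω) (predual V) (derivation ω e) := by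
  refine weakStarContinuous_of_comp_mem _ fun φ hφ => ?_
  rw [WeightedL1.predual_eq_cZeroDual, mem_cZeroDual]
  refine tendsto_cofinite_of_injective (pure_le_nhds 0) (fun n hn => ?_) (e := e) ?_
  · have : derivation ω e (unitVec (WeightedL1.isometry ω) n) = 0 := by
      ext (⟨v', w'⟩ | v' | w') <;> simp [unitVec_apply_of_notMem_range e hn]
    rw [ContinuousLinearMap.comp_apply, this, map_zero]
  · have h1 := (mem_predual.1 hφ).comp row_injective.tendsto_cofinite
    have h2 := (mem_predual.1 hφ).comp col_injective.tendsto_cofinite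
    simpa [derivation_unitVec, Function.comp_def] using h1.sub h2

/-- At an element `a` without zeros, `a ⊗ 1 - 1 ⊗ a = a · x - x · a` forces the `⊗ 1` part of `x`
to be the constant sequence `1`, which is not summable. -/
lemma not_isInnerAt_derivation [Infinite V] {a : WeightedL1 ω} (ha : ∀ v, a (e v) ≠ 0) :
    ¬ (bimodule ω e).IsInnerAt (derivation ω e) a := by
  rintro ⟨x, hx⟩
  have h1 (v : V) : ((ω (e v) : ℝ) : ℂ) = x (row v) := by
    have := congrArg (fun y : EllOne (TensorIndex V) => y (row v)) hx
    simpa [bimodule, ha v] using this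
  have h2 := ((EllOne.summable_norm x).comp_injective row_injective).tendsto_cofinite_zero
  obtain ⟨v, hv⟩ := (h2.eventually (gt_mem_nhds zero_lt_one)).exists
  rw [Function.comp_apply, ← h1, WeightedL1.norm_weight] at hv
  exact absurd (ω (e v)).2 (not_le.2 hv)

end TensorBimodule

/-! ### Functionals applied to commutators with basis vectors -/

namespace TensorBimodule

open TensorIndex

variable {ω : ℕ → Set.Ici (1 : ℝ)} {V : Type v} (e : V ↪ ℕ)

lemma hasSum_right_basis_row (a : WeightedL1 ω) (φ : StrongDual ℂ (EllOne (TensorIndex V)))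
    (v : V) :
    HasSum (fun w => a (e w) * ((ω (e w) : ℝ) : ℂ) * φ (EllOne.basis (pair v w)))
      (φ (right e a (EllOne.basis (row v)))) := by
  classical
  have hinj : Function.Injective fun w => pair v w := fun w w' h => by simpa using h
  have h := hasSum_apply (LinearIsometryEquiv.refl ℂ (EllOne (TensorIndex V))) φ
    (right e a (EllOne.basis (row v)))
  refine ((hinj.hasSum_iff ?_).2 h).congr_fun fun w => ?_
  · rintro (⟨v', w'⟩ | v' | w') hi
    · have : v' ≠ v := by rintro rfl; exact hi ⟨w', rfl⟩
      simp [EllOne.basis_apply, this]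
    · simp
    · simp [EllOne.basis_apply]
  · have h0 : EllOne.basis (row v) (pair v w) = 0 := EllOne.basis_ne (by simp)
    change _ = right e a (EllOne.basis (row v)) (pair v w) * φ (EllOne.basis (pair v w))
    rw [right_pair, h0, EllOne.basis_self, mul_zero, zero_add, mul_one]

lemma hasSum_left_basis_col (a : WeightedL1 ω) (φ : StrongDual ℂ (EllOne (TensorIndex V)))
    (w : V) :
    HasSum (fun v => a (e v) * ((ω (e v) : ℝ) : ℂ) * φ (EllOne.basis (pair v w)))
      (φ (left e a (EllOne.basis (col w)))) := by
  have h := hasSum_right_basis_row e a (φ.comp flip) w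
  have h1 : right e a (EllOne.basis (row w)) = flip (left e a (EllOne.basis (col w))) := by
    rw [right_apply, flip_basis, swap_row]
  have h2 (x : EllOne (TensorIndex V)) : flip (flip x) = x := by
    ext i; simp [swap_involutive i]
  simpa only [ContinuousLinearMap.comp_apply, flip_basis, swap_pair, h1, h2] using h

lemma right_basis_pair (a : WeightedL1 ω) (v w : V) :
    right e a (EllOne.basis (pair v w)) = a (e w) • EllOne.basis (pair v w) := by
  rw [right_apply, flip_basis, swap_pair, left_basis_pair, map_smul, flip_basis, swap_pair]

lemma right_basis_col (a : WeightedL1 ω) (w : V) :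
    right e a (EllOne.basis (col w)) = a (e w) • EllOne.basis (col w) := by
  rw [right_apply, flip_basis, swap_col, left_basis_row, map_smul, flip_basis, swap_row]

end TensorBimodule

/-! ### A unit flow to infinity through levels of growing size -/

/-- The vertices of the graph carrying the flow: level `j` has `16 ^ j` vertices, and any two
vertices in consecutive levels are joined. -/
abbrev LevelVertex : Type v := Σ j : ℕ, ULift.{v} (Fin (16 ^ j))

/-- The unit flow from the root to infinity that spreads evenly over the edges between consecutive
levels, as a function of the levels of the two ends of the edge. -/
def levelFlow (i j : ℕ) : ℝ :=
  (if j = i + 1 then ((16 : ℝ) ^ i * 16 ^ j)⁻¹ else 0) -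
    (if i = j + 1 then ((16 : ℝ) ^ i * 16 ^ j)⁻¹ else 0)

lemma levelFlow_swap (i j : ℕ) : levelFlow j i = -levelFlow i j := by
  simp only [levelFlow, mul_comm ((16 : ℝ) ^ j), neg_sub]

lemma levelFlow_eq_zero {i j : ℕ} (h1 : j ≠ i + 1) (h2 : i ≠ j + 1) : levelFlow i j = 0 := by
  simp [levelFlow, h1, h2]

lemma levelFlow_sign (i j : ℕ) : (levelFlow i j : ℂ) * ((-1) ^ i + (-1) ^ j) = 0 := by
  by_cases h1 : j = i + 1
  · subst h1; simp [pow_succ]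
  by_cases h2 : i = j + 1
  · subst h2; simp [pow_succ]
  simp [levelFlow_eq_zero h1 h2]

lemma abs_levelFlow_le (i j : ℕ) : |levelFlow i j| * (64 ^ i + 64 ^ j) ≤ 9 * (1 / 2) ^ (i + j) := by
  have key (i : ℕ) : |levelFlow i (i + 1)| * (64 ^ i + 64 ^ (i + 1)) ≤
      9 * (1 / 2) ^ (i + (i + 1)) := by
    have h0 : (0 : ℝ) < 4 ^ i := by positivity
    have h16 : (16 : ℝ) ^ i = (4 ^ i) ^ 2 := by rw [← pow_mul, mul_comm, pow_mul]; norm_num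
    have h64 : (64 : ℝ) ^ i = (4 ^ i) ^ 3 := by rw [← pow_mul, mul_comm, pow_mul]; norm_num
    have h2 : (1 / 2 : ℝ) ^ (i + (i + 1)) = (2 * 4 ^ i)⁻¹ := by
      rw [show i + (i + 1) = 2 * i + 1 by ring, pow_succ, pow_mul]
      rw [mul_inv, mul_comm, one_div, inv_pow, ← inv_pow, ← inv_pow]
      norm_num
    have h3 : levelFlow i (i + 1) = ((4 ^ i) ^ 2 * ((4 ^ i) ^ 2 * 16))⁻¹ := by
      rw [← h16]
      have : ¬ i = i + 1 + 1 := by omega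
      simp [levelFlow, pow_succ, this]
    rw [h3, h2, pow_succ (64 : ℝ), h64, abs_of_pos (by positivity)]
    field_simp
    norm_num
  by_cases h1 : j = i + 1
  · subst h1; exact key i
  by_cases h2 : i = j + 1
  · subst h2
    rw [levelFlow_swap, abs_neg, add_comm ((64 : ℝ) ^ _), add_comm (j + 1) j]
    exact key j
  rw [levelFlow_eq_zero h1 h2]
  simp

lemma LevelVertex.finite_preimage (n : ℕ) : {v : LevelVertex.{v} | v.1 ≤ n}.Finite := by
  classical
  refine ((Finset.range (n + 1)).sigma fun j =>
    (Finset.univ : Finset (ULift.{v} (Fin (16 ^ j))))).finite_toSet.subset fun v hv => ?_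
  simpa [Nat.lt_succ_iff] using hv

lemma LevelVertex.hasSum_ite_level (k : ℕ) (c : ℂ) :
    HasSum (fun v : LevelVertex.{v} => if v.1 = k then c else 0) (16 ^ k * c) := by
  refine HasSum.sigma_of_hasSum (hasSum_ite_eq k (16 ^ k * c)) (fun j => ?_) ?_
  · have h := hasSum_fintype (fun _ : ULift.{v} (Fin (16 ^ j)) => if j = k then c else 0)
    by_cases hj : j = k
    · subst hj; simpa using h
    · simp [hj]
  · refine summable_of_hasFiniteSupport ((LevelVertex.finite_preimage k).subset fun v hv => ?_)
    by_contra hk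
    exact hv (if_neg fun h => hk h.le)

/-- The net outflow is `1` at the root and `0` elsewhere. -/
lemma hasSum_levelFlow (w : LevelVertex.{v}) :
    HasSum (fun v : LevelVertex.{v} => (levelFlow w.1 v.1 : ℂ)) (if w.1 = 0 then 1 else 0) := by
  obtain ⟨i, -⟩ := w
  have h16 (k : ℕ) : (16 : ℂ) ^ k ≠ 0 := pow_ne_zero _ (by norm_num)
  have h1 := LevelVertex.hasSum_ite_level.{v} (i + 1) (((16 : ℂ) ^ i * 16 ^ (i + 1))⁻¹)
  rcases i with _ | i
  · have hs : (16 : ℂ) ^ (0 + 1) * ((16 : ℂ) ^ 0 * 16 ^ (0 + 1))⁻¹ = 1 := by norm_num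
    rw [hs] at h1
    refine h1.congr_fun fun v => ?_
    by_cases hv : v.1 = 1 <;> simp [levelFlow, hv]
  · have h2 := h1.sub (LevelVertex.hasSum_ite_level.{v} i (((16 : ℂ) ^ (i + 1) * 16 ^ i)⁻¹))
    have hs : (16 : ℂ) ^ (i + 1 + 1) * ((16 : ℂ) ^ (i + 1) * 16 ^ (i + 1 + 1))⁻¹ -
        16 ^ i * ((16 : ℂ) ^ (i + 1) * 16 ^ i)⁻¹ = 0 := by
      have := h16 i
      rw [pow_succ, pow_succ]
      field_simp
      norm_num
    rw [hs] at h2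
    refine (if_neg (Nat.succ_ne_zero i) : (if i + 1 = 0 then (1 : ℂ) else 0) = 0) ▸
      h2.congr_fun fun v => ?_
    simp only [levelFlow, add_left_inj, eq_comm (a := i)]
    have hne : ¬ i + 1 + 1 = i := by omega
    have hne' : ¬ i = i + 1 + 1 := by omega
    by_cases hv : v.1 = i + 1 + 1 <;> by_cases hv' : v.1 = i <;> simp [hv, hv', hne, hne']

lemma LevelVertex.tendsto_half_pow :
    Tendsto (fun p : LevelVertex.{v} × LevelVertex.{v} => (1 / 2 : ℝ) ^ (p.1.1 + p.2.1))
      cofinite (𝓝 0) := by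
  refine (tendsto_pow_atTop_nhds_zero_of_lt_one (by norm_num) (by norm_num)).comp ?_
  rw [← Nat.cofinite_eq_atTop]
  refine Tendsto.cofinite_of_finite_preimage_singleton fun n => ?_
  refine ((LevelVertex.finite_preimage n).prod (LevelVertex.finite_preimage n)).subset ?_
  rintro ⟨v, w⟩ h
  have h : v.1 + w.1 = n := h
  exact ⟨show v.1 ≤ n by omega, show w.1 ≤ n by omega⟩

lemma LevelVertex.summable_pow :
    Summable fun v : LevelVertex.{v} => ((64 : ℝ) ^ v.1)⁻¹ := by
  refine (summable_sigma_of_nonneg fun v => by positivity).2 ⟨fun j => ?_, ?_⟩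
  · exact (hasSum_fintype _).summable
  · refine (summable_geometric_of_lt_one (r := 1 / 4) (by norm_num) (by norm_num)).congr
      fun j => ?_
    have h64 : (64 : ℝ) ^ j = 16 ^ j * 4 ^ j := by rw [← mul_pow]; norm_num
    simp [h64]
    field_simp

/-! ### The obstruction to simultaneous approximation at two elements -/

namespace TensorBimodule

open TensorIndex

variable {ω : ℕ → Set.Ici (1 : ℝ)} (e : LevelVertex.{v} ↪ ℕ)

/-- Coefficients of two functionals `φ₁` (`ε = 1`, `r = 1`) and `φ₂` (`ε = -1`, `r = 0`). On pairs
they solve, up to weights, the system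
`a₁ v φ₁ + a₂ v φ₂ = a₁ w φ₁ + a₂ w φ₂ = levelFlow v w`,
where `a₁ v = 64⁻ʲ` and `a₂ v = (-1)ʲ 64⁻ʲ` on level `j`: the signs of `a₂` at the two ends of an
edge differ. The root terms of `φ₁` balance the divergence of the flow. -/
def flowCoeff (ω : ℕ → Set.Ici (1 : ℝ)) (ε : ℂ) (r : ℂ) : TensorIndex LevelVertex.{v} → ℂ
  | pair v w => (ε ^ v.1 * levelFlow v.1 w.1 / 2) *
      (64 ^ v.1 / ((ω (e w) : ℝ) : ℂ) + ε * (64 ^ w.1 / ((ω (e v) : ℝ) : ℂ)))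
  | row v => if v.1 = 0 then r else 0
  | col v => if v.1 = 0 then -r else 0

/-- The functionals lie in `c₀`: on the edges between levels `j` and `j + 1` the flow is of order
`16⁻²ʲ`, and division by `64⁻ʲ` still leaves `4⁻ʲ`. -/
lemma exists_flowFunctional (ω : ℕ → Set.Ici (1 : ℝ)) {ε : ℂ} (hε : ‖ε‖ = 1) (r : ℂ) :
    ∃ φ ∈ predual LevelVertex.{v}, ∀ i, φ (EllOne.basis i) = flowCoeff e ω ε r i := by
  have hp (v w : LevelVertex.{v}) :
      ‖flowCoeff e ω ε r (pair v w)‖ ≤ 9 * (1 / 2) ^ (v.1 + w.1) := by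
    have hw (v w : LevelVertex.{v}) : ‖(64 : ℂ) ^ v.1 / ((ω (e w) : ℝ) : ℂ)‖ ≤ 64 ^ v.1 := by
      rw [norm_div, WeightedL1.norm_weight]
      simpa using div_le_self (by positivity) (ω (e w)).2
    refine le_trans ?_ (abs_levelFlow_le v.1 w.1)
    have h1 : ‖(64 : ℂ) ^ v.1 / ((ω (e w) : ℝ) : ℂ) + ε * (64 ^ w.1 / ((ω (e v) : ℝ) : ℂ))‖ ≤
        64 ^ v.1 + 64 ^ w.1 := by
      refine (norm_add_le _ _).trans (add_le_add (hw _ _) ?_)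
      rw [norm_mul, hε, one_mul]
      exact hw _ _
    rw [flowCoeff, norm_mul]
    refine mul_le_mul ?_ h1 (norm_nonneg _) (abs_nonneg _)
    rw [norm_div, norm_mul, norm_pow, hε, one_pow, one_mul, Complex.norm_real, Real.norm_eq_abs]
    simp
  have hroot (c : ℂ) :
      Tendsto (fun v : LevelVertex.{v} => if v.1 = 0 then c else 0) cofinite (𝓝 0) := by
    refine (tendsto_const_nhds (x := (0 : ℂ))).congr' ?_
    filter_upwards [(LevelVertex.finite_preimage 0).compl_mem_cofinite] with v hv
    rw [if_neg fun h => hv h.le]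
  obtain ⟨φ, hφ⟩ := EllOne.exists_functional (flowCoeff e ω ε r) (C := 9 + ‖r‖) (by positivity) (by
    rintro (⟨v, w⟩ | v | v)
    · refine (hp v w).trans ?_
      have : (1 / 2 : ℝ) ^ (v.1 + w.1) ≤ 1 := pow_le_one₀ (by norm_num) (by norm_num)
      linarith [norm_nonneg r]
    · by_cases h : v.1 = 0 <;> simp [flowCoeff, h]
      positivity
    · by_cases h : v.1 = 0 <;> simp [flowCoeff, h]
      positivity)
  refine ⟨φ, ?_, hφ⟩
  rw [mem_predual]
  simp only [hφ]
  refine TensorIndex.tendsto_cofinite ?_ (hroot r) (hroot (-r))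
  exact squeeze_zero_norm (fun p => hp p.1 p.2)
    (by simpa using LevelVertex.tendsto_half_pow.const_mul 9)

/-- The elements `a₁` (`ε = 1`) and `a₂` (`ε = -1`); they lie in `ℓ¹(ω)` since level `j` has
`16 ^ j` vertices of mass `64⁻ʲ`. -/
lemma exists_flowElement (ω : ℕ → Set.Ici (1 : ℝ)) {ε : ℂ} (hε : ‖ε‖ = 1) :
    ∃ a : WeightedL1 ω, ∀ v, a (e v) = ε ^ v.1 / (64 ^ v.1 * ((ω (e v) : ℝ) : ℂ)) := by
  refine WeightedL1.exists_apply_eq e _ (LevelVertex.summable_pow.congr fun v => ?_)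
  rw [norm_div, norm_mul, norm_pow, norm_pow, hε, WeightedL1.norm_weight]
  have := (WeightedL1.weight_pos ω (e v)).ne'
  field_simp
  simp

/-- The first equation of the system that defines `flowCoeff`. -/
lemma flow_sum_left (v w : LevelVertex.{v}) :
    (64 ^ v.1)⁻¹ * flowCoeff e ω 1 1 (pair v w) +
      (-1) ^ v.1 * (64 ^ v.1)⁻¹ * flowCoeff e ω (-1) 0 (pair v w) =
      levelFlow v.1 w.1 / ((ω (e w) : ℝ) : ℂ) := by
  have h1 : ((-1 : ℂ) ^ v.1) * (-1) ^ v.1 = 1 := by rw [← mul_pow]; simp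
  have h64 : (64 : ℂ) ^ v.1 ≠ 0 := pow_ne_zero _ (by norm_num)
  have hw := WeightedL1.weight_ne_zero ω (e w)
  have hv := WeightedL1.weight_ne_zero ω (e v)
  simp only [flowCoeff, one_pow]
  field_simp
  linear_combination (levelFlow v.1 w.1 : ℂ) *
    (64 ^ v.1 * ((ω (e v) : ℝ) : ℂ) - 64 ^ w.1 * ((ω (e w) : ℝ) : ℂ)) * h1

/-- The second equation of the system that defines `flowCoeff`; it uses that the ends of an edge
have opposite signs. -/
lemma flow_sum_right (v w : LevelVertex.{v}) :
    (64 ^ w.1)⁻¹ * flowCoeff e ω 1 1 (pair v w) +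
      (-1) ^ w.1 * (64 ^ w.1)⁻¹ * flowCoeff e ω (-1) 0 (pair v w) =
      levelFlow v.1 w.1 / ((ω (e v) : ℝ) : ℂ) := by
  have h1 : ((-1 : ℂ) ^ w.1) * (-1) ^ w.1 = 1 := by rw [← mul_pow]; simp
  have h2 := levelFlow_sign v.1 w.1
  have h64 : (64 : ℂ) ^ w.1 ≠ 0 := pow_ne_zero _ (by norm_num)
  have hw := WeightedL1.weight_ne_zero ω (e w)
  have hv := WeightedL1.weight_ne_zero ω (e v)
  simp only [flowCoeff, one_pow]
  field_simp
  linear_combination (64 ^ v.1 * ((ω (e v) : ℝ) : ℂ) - 64 ^ w.1 * ((ω (e w) : ℝ) : ℂ)) *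
    ((-1) ^ w.1 * h2 - (levelFlow v.1 w.1 : ℂ) * h1)

/-- The functional `x ↦ φ₁ (a₁ · x - x · a₁) + φ₂ (a₂ · x - x · a₂)` vanishes. On the basis vectors
`v ⊗ w` this is the coincidence of the two equations that define `flowCoeff`; on `v ⊗ 1` and `1 ⊗ w`
it is the conservation of the flow. -/
lemma flow_commutator {a₁ a₂ : WeightedL1 ω}
    (ha₁ : ∀ v, a₁ (e v) = 1 ^ v.1 / (64 ^ v.1 * ((ω (e v) : ℝ) : ℂ)))
    (ha₂ : ∀ v, a₂ (e v) = (-1) ^ v.1 / (64 ^ v.1 * ((ω (e v) : ℝ) : ℂ)))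
    {φ₁ φ₂ : StrongDual ℂ (EllOne (TensorIndex LevelVertex.{v}))}
    (hφ₁ : ∀ i, φ₁ (EllOne.basis i) = flowCoeff e ω 1 1 i)
    (hφ₂ : ∀ i, φ₂ (EllOne.basis i) = flowCoeff e ω (-1) 0 i)
    (x : EllOne (TensorIndex LevelVertex.{v})) :
    φ₁ (left e a₁ x - right e a₁ x) + φ₂ (left e a₂ x - right e a₂ x) = 0 := by
  let Ψ : StrongDual ℂ (EllOne (TensorIndex LevelVertex.{v})) :=
    φ₁.comp (left e a₁ - right e a₁) + φ₂.comp (left e a₂ - right e a₂)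
  have hb₁ (v : LevelVertex.{v}) : a₁ (e v) * ((ω (e v) : ℝ) : ℂ) = (64 ^ v.1)⁻¹ := by
    have := WeightedL1.weight_ne_zero ω (e v)
    rw [ha₁, one_pow]
    field_simp
  have hb₂ (v : LevelVertex.{v}) :
      a₂ (e v) * ((ω (e v) : ℝ) : ℂ) = (-1) ^ v.1 * (64 ^ v.1)⁻¹ := by
    have := WeightedL1.weight_ne_zero ω (e v)
    rw [ha₂]
    field_simp
  have hroot (v : LevelVertex.{v}) : a₁ (e v) * (if v.1 = 0 then 1 else 0) =
      (if v.1 = 0 then 1 else 0) / ((ω (e v) : ℝ) : ℂ) := by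
    rw [ha₁]
    split_ifs with h <;> simp [h]
  refine mem_of_unitVec_mem (LinearIsometryEquiv.refl ℂ _) (S := LinearMap.ker Ψ.toLinearMap)
    Ψ.isClosed_ker (fun i => ?_) x
  change φ₁ (left e a₁ (EllOne.basis i) - right e a₁ (EllOne.basis i)) +
    φ₂ (left e a₂ (EllOne.basis i) - right e a₂ (EllOne.basis i)) = 0
  rcases i with ⟨v, w⟩ | v | w
  · have hv := WeightedL1.weight_ne_zero ω (e v)
    have hw := WeightedL1.weight_ne_zero ω (e w)
    have h1 := flow_sum_left (ω := ω) e v w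
    have h2 := flow_sum_right (ω := ω) e v w
    rw [← hb₂, ← hb₁, eq_div_iff hw] at h1
    rw [← hb₂, ← hb₁, eq_div_iff hv] at h2
    simp only [left_basis_pair, right_basis_pair, map_sub, map_smul, hφ₁, hφ₂, smul_eq_mul]
    refine mul_right_cancel₀ (mul_ne_zero hv hw) ?_
    linear_combination h1 - h2
  · have h := (hasSum_right_basis_row e a₁ φ₁ v).add (hasSum_right_basis_row e a₂ φ₂ v)
    simp only [hφ₁, hφ₂, hb₁, hb₂, flow_sum_right] at h
    have h2 := h.unique ((hasSum_levelFlow v).div_const _)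
    simp only [left_basis_row, map_sub, map_smul, hφ₁, hφ₂, smul_eq_mul]
    have h3 := hroot v
    simp only [flowCoeff, ite_self, mul_zero]
    linear_combination h3 - h2
  · have h := (hasSum_left_basis_col e a₁ φ₁ w).add (hasSum_left_basis_col e a₂ φ₂ w)
    simp only [hφ₁, hφ₂, hb₁, hb₂, flow_sum_left] at h
    have h2 := h.unique (((hasSum_levelFlow w).neg.congr_fun fun v => by
      rw [levelFlow_swap]; push_cast; rfl).div_const _)
    simp only [right_basis_col, map_sub, map_smul, hφ₁, hφ₂, smul_eq_mul]
    have h3 := hroot w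
    have h4 : flowCoeff e ω 1 1 (col w) = -(if w.1 = 0 then 1 else 0) := by
      simp only [flowCoeff]; split_ifs <;> simp
    have h5 : flowCoeff e ω (-1) 0 (col w) = 0 := by simp [flowCoeff]
    rw [h4, h5]
    linear_combination h3 + h2

lemma not_isWeakStarApproxInner_derivation (ω : ℕ → Set.Ici (1 : ℝ)) :
    ¬ (bimodule ω e).IsWeakStarApproxInner (predual LevelVertex.{v}) (derivation ω e) := by
  obtain ⟨a₁, ha₁⟩ := exists_flowElement e ω (ε := 1) (by simp)
  obtain ⟨a₂, ha₂⟩ := exists_flowElement e ω (ε := -1) (by simp)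
  obtain ⟨φ₁, hφ₁, hy₁⟩ := exists_flowFunctional e ω (ε := 1) (by simp) 1
  obtain ⟨φ₂, hφ₂, hy₂⟩ := exists_flowFunctional e ω (ε := -1) (by simp) 0
  refine (bimodule ω e).not_isWeakStarApproxInner hφ₁ hφ₂ a₁ a₂
    (flow_commutator e ha₁ ha₂ hy₁ hy₂) ?_
  have h₁ := hasSum_apply (LinearIsometryEquiv.refl ℂ _) φ₁ (derivation ω e a₁)
  have h₂ := hasSum_apply (LinearIsometryEquiv.refl ℂ _) φ₂ (derivation ω e a₂)
  change HasSum (fun i => derivation ω e a₁ i * φ₁ (EllOne.basis i)) _ at h₁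
  change HasSum (fun i => derivation ω e a₂ i * φ₂ (EllOne.basis i)) _ at h₂
  -- `D a₁` has coordinates `1` and `-1` at `root ⊗ 1` and `1 ⊗ root`, where `φ₁` has the values `1`
  -- and `-1`; all other terms of the two pairings vanish.
  let root : LevelVertex.{v} := ⟨0, ⟨0⟩⟩
  have hroot (v : LevelVertex.{v}) (hv : v.1 = 0) : v = root := by
    obtain ⟨j, k⟩ := v
    obtain rfl : j = 0 := hv
    have : Subsingleton (ULift.{v} (Fin (16 ^ 0))) := inferInstanceAs (Subsingleton (ULift (Fin 1)))
    rw [Subsingleton.elim k ⟨0⟩]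
  have h3 : φ₂ (derivation ω e a₂) = 0 := by
    refine h₂.unique (hasSum_zero.congr_fun fun i => ?_)
    rcases i with ⟨v, w⟩ | v | w <;> simp [hy₂, flowCoeff]
  have h4 : φ₁ (derivation ω e a₁) = 2 := by
    classical
    refine (h₁.unique (hasSum_sum_of_ne_finset_zero (s := {row root, col root}) ?_)).trans ?_
    · rintro (⟨v, w⟩ | v | w) hi
      · simp
      · have : ¬ v.1 = 0 := fun h => hi (by simp [hroot v h])
        simp [hy₁, flowCoeff, this]
      · have : ¬ w.1 = 0 := fun h => hi (by simp [hroot w h])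
        simp [hy₁, flowCoeff, this]
    · rw [Finset.sum_pair (by simp)]
      simp [hy₁, flowCoeff, ha₁, root, WeightedL1.weight_ne_zero ω,
        one_add_one_eq_two]
  rw [h3, h4]
  norm_num

lemma exists_not_isInnerAt_derivation (ω : ℕ → Set.Ici (1 : ℝ)) :
    ∃ a : WeightedL1 ω, ¬ (bimodule ω e).IsInnerAt (derivation ω e) a := by
  obtain ⟨a, ha⟩ := exists_flowElement e ω (ε := 1) (by simp)
  refine ⟨a, not_isInnerAt_derivation e fun v => ?_⟩
  rw [ha]
  exact div_ne_zero (by simp) (mul_ne_zero (by simp) (WeightedL1.weight_ne_zero ω _))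

end TensorBimodule

end

theorem theorem3p1 (ω : ℕ → Set.Ici (1 : ℝ)) :
    IsDualBanachAlgebra (WeightedL1 ω) (WeightedL1.predual ω) ∧
    ¬ IsConnesAmenable.{0, v} (WeightedL1 ω) (WeightedL1.predual ω) ∧
    ¬ IsPointwiseConnesAmenable.{0, v} (WeightedL1 ω) (WeightedL1.predual ω) ∧
    ¬ IsWeakStarApproxConnesAmenable.{0, v} (WeightedL1 ω) (WeightedL1.predual ω) ∧
    IsPointwiseWeakStarApproxConnesAmenable.{0, v} (WeightedL1 ω) (WeightedL1.predual ω) := by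
  obtain ⟨e, he⟩ := Countable.exists_injective_nat LevelVertex.{v}
  let e : LevelVertex.{v} ↪ ℕ := ⟨e, he⟩
  obtain ⟨a, ha⟩ := TensorBimodule.exists_not_isInnerAt_derivation e ω
  have hP := TensorBimodule.isPredual ω e
  have hN := TensorBimodule.isNormal ω e
  have hD := TensorBimodule.isDerivation_derivation (ω := ω) e
  have hw := TensorBimodule.weakStarContinuous_derivation ω e
  refine ⟨WeightedL1.isDualBanachAlgebra ω, fun h => ?_, fun h => ?_, fun h => ?_,
    WeightedL1.isPointwiseWeakStarApproxConnesAmenable ω⟩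
  · obtain ⟨x, hx⟩ := h _ _ _ hP hN _ hD hw
    exact ha ⟨x, hx a⟩
  · exact ha (h a _ _ _ hP hN _ hD hw)
  · exact TensorBimodule.not_isWeakStarApproxInner_derivation e ω (h _ _ _ hP hN _ hD hw)
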